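/- Let $K$ be a field, let $1\le p\le\infty$, and let either $P\subseteq\mathbb R$ be Lebesgue measurable with $\mu$ the Lebesgue measure on $P$, or $P\subseteq\mathbb Z$ with $\mu$ the counting measure on $P$. For a family $x=\{x_a\}_{a\in A}$ in $[0,\infty]$ put $\|x\|_p=(\sum_a x_a^p)^{1/p}\in[0,\infty]$ if $p<\infty$, and $\|x\|_\infty=\sup_a x_a$. A persistence module is a functor from the poset $(P,\le)$ to the category of $K$-vector spaces. An interval of $P$ is an order-convex subset $I\subseteq P$. If $I\ne\varnothing$, its interval module is $K$ at the points of $I$ and $0$ elsewhere, with identity maps between points of $I$ and zero maps otherwise; to $I=\varnothing$ corresponds the zero module. A finite zigzag of morphisms of persistence modules $M=M_0\to M_1\leftarrow M_2\to\cdots\leftarrow M_n=N$ (each morphism $\gamma_i$ may point in either direction) has cost $$\sum_{i=1}^n\Big(\int_P\dim\ker\gamma_i(a)\,d\mu(a)+\int_P\dim\operatorname{coker}\gamma_i(a)\,d\mu(a)\Big),$$ and $d_\mu(M,N)\in[0,\infty]$ is the infimum of the costs of all zigzags from $M$ to $N$ for which all these integrands are measurable (and $\infty$ if there are none). The algebraic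 $p$-Wasserstein distance is $$W_p(d_\mu)(M,N)=\inf\ \big\|\{d_\mu(M_a,N_a)\}_{a\in A}\big\|_p ,$$ the infimum over all isomorphisms $M\cong\coprod_{a\in A}M_a$, $N\cong\coprod_{a\in A}N_a$ in which every $M_a$ and every $N_a$ is zero or has a local endomorphism ring. To a nonempty interval $I$ of $P$ assign the point $x(I)\in[-\infty,\infty]^2$ given by $x(I)=(\inf I,\sup I)$ if $P\subseteq\mathbb R$, and by $x(I)=(\inf I,1+\sup I)$ if $P\subseteq\mathbb Z$ (the end points of the half-open real interval $\bigcup_{a\in I}[a,a+1)$). If $M\cong\coprod_{j\in J}I_j$ with interval modules $I_j$ of nonempty intervals, then $M$ has the persistence diagram $\operatorname{Dgm}M=\{x(I_j)\}_{j\in J}$, a multiset. Let $d(x,y)=\|x-y\|_1$ on $[-\infty,\infty]^2$ (with $|\infty-\infty|=|(-\infty)-(-\infty)|=0$), let $\Delta$ be the diagonal, and $d(x,\Delta)=\inf_{y\in\Delta}d(x,y)$. For diagrams $\{x_a\}_{a\in A}$ and $\{x'_b\}_{b\in B}$, $$W_p\big(\{x_a\},\{x'_b\}\big)=\inf_{\varphi}\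 \Big\|\Big(\big\|\{d(x_c,x'_{\varphi(c)})\}_{c\in C}\big\|_p,\ \big\|\{d(x_a,\Delta)\}_{a\in A\setminus C}\big\|_p,\ \big\|\{d(x'_b,\Delta)\}_{b\in B\setminus\varphi(C)}\big\|_p\Big)\Big\|_p ,$$ the infimum over all $C\subseteq A$ and all injections $\varphi:C\to B$. **Theorem ($W_p$ isometry).** Let $M,N$ be persistence modules indexed by $P$ that have persistence diagrams. Then $$W_p(d_\mu)(M,N)=\inf\ \big\|\{\mu(M_a\mathbin{\triangle}N_a)\}_{a\in A}\big\|_p ,$$ the infimum over all isomorphisms $M\cong\coprod_{a\in A}M_a$, $N\cong\coprod_{a\in A}N_a$ in which every $M_a$ and every $N_a$ is an interval module or zero (identified with its interval, respectively with $\varnothing$). If moreover $P$ has no gaps, that is, if $P\subseteq\mathbb R$ differs from its convex hull by a Lebesgue null set (for example, $P$ is an interval), respectively if $P\subseteq\mathbb Z$ is a set of consecutive integers (possibly infinite), then both are equal to $$W_p(\operatorname{Dgm}M,\operatorname{Dgm}N).$$ -/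

import Mathlib

open CategoryTheory CategoryTheory.Limits MeasureTheory
open scoped ENNReal

universe u

noncomputable section

namespace AlgWass

/-- The `p`-norm of a family with values in `[0,∞]`, infinite values allowed. -/
def pNorm (p : ℝ≥0∞) {ι : Type*} (x : ι → ℝ≥0∞) : ℝ≥0∞ :=
  open Classical in
  if p = ∞ then ⨆ i, x i else (∑' i, x i ^ p.toReal) ^ (1 / p.toReal)

/-- Persistence modules indexed by the preorder `P` with values in `K`-vector spaces. -/
abbrev PersMod (K : Type u) [Field K] (P : Type) [Preorder P] : Type (u + 1) :=
  P ⥤ ModuleCat.{u} K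

section Cost

variable {K : Type u} [Field K] {P : Type} [Preorder P]

/-- The Hilbert function of the kernel of a morphism. -/
def dimKer {M N : PersMod K P} (f : M ⟶ N) (a : P) : ℝ≥0∞ :=
  ((Cardinal.toENat (Module.rank K (LinearMap.ker (f.app a).hom)) : ℕ∞) : ℝ≥0∞)

/-- The Hilbert function of the cokernel of a morphism. -/
def dimCoker {M N : PersMod K P} (f : M ⟶ N) (a : P) : ℝ≥0∞ :=
  ((Cardinal.toENat (Module.rank K (N.obj a ⧸ LinearMap.range (f.app a).hom)) : ℕ∞) : ℝ≥0∞)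

/-- Finite zigzags of morphisms; each morphism may point in either direction. -/
inductive Zigzag : PersMod K P → PersMod K P → Type (u + 1)
  | nil (M : PersMod K P) : Zigzag M M
  | fwd {M M' N : PersMod K P} (f : M ⟶ M') (γ : Zigzag M' N) : Zigzag M N
  | bwd {M M' N : PersMod K P} (f : M' ⟶ M) (γ : Zigzag M' N) : Zigzag M N

variable [MeasurableSpace P]

/-- All kernels and cokernels in the zigzag have measurable Hilbert functions. -/
def Zigzag.IsMeasurable : {M N : PersMod K P} → Zigzag M N → Prop
  | _, _, .nil _ => True
  | _, _, .fwd f γ => Measurable (dimKer f) ∧ Measurable (dimCoker f) ∧ γ.IsMeasurable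
  | _, _, .bwd f γ => Measurable (dimKer f) ∧ Measurable (dimCoker f) ∧ γ.IsMeasurable

/-- The sum of the weights of all kernels and cokernels in the zigzag. -/
def Zigzag.cost (μ : Measure P) : {M N : PersMod K P} → Zigzag M N → ℝ≥0∞
  | _, _, .nil _ => 0
  | _, _, .fwd f γ => (∫⁻ a, dimKer f a ∂μ + ∫⁻ a, dimCoker f a ∂μ) + γ.cost μ
  | _, _, .bwd f γ => (∫⁻ a, dimKer f a ∂μ + ∫⁻ a, dimCoker f a ∂μ) + γ.cost μ

/-- The distance `d_μ`: the infimal cost of a (measurable) zigzag. -/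
def zigzagDist (μ : Measure P) (M N : PersMod K P) : ℝ≥0∞ :=
  ⨅ (γ : Zigzag M N) (_ : γ.IsMeasurable), γ.cost μ

end Cost

/-- The algebraic `p`-Wasserstein distance `W_p(d)` : the infimum of `‖{d(M_a, N_a)}‖_p` over all
`M ≅ ∐ M_a` and `N ≅ ∐ N_a` in which every `M_a` and `N_a` is zero or has a local endomorphism
ring. -/
def algWasserstein {𝒜 : Type (u + 1)} [Category.{u} 𝒜] [Preadditive 𝒜] [HasCoproducts.{u} 𝒜]
    (p : ℝ≥0∞) (d : 𝒜 → 𝒜 → ℝ≥0∞) (M N : 𝒜) : ℝ≥0∞ :=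
  ⨅ (A : Type u) (X : A → 𝒜) (Y : A → 𝒜)
    (_ : Nonempty (M ≅ ∐ X)) (_ : Nonempty (N ≅ ∐ Y))
    (_ : ∀ a, IsZero (X a) ∨ IsLocalRing (End (X a)))
    (_ : ∀ a, IsZero (Y a) ∨ IsLocalRing (End (Y a))),
    pNorm p (fun a => d (X a) (Y a))

/-- A possibly empty interval of `P`, that is, an order-convex subset. -/
abbrev Intvl (P : Type) [Preorder P] : Type := {I : Set P // I.OrdConnected}

/-- The value at `a` of the interval module of `I`: it is `K` if `a ∈ I` and `0` otherwise. -/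
def intervalFiber (K : Type u) [Field K] {P : Type} [Preorder P] (I : Intvl P) (a : P) :
    Submodule K K where
  carrier := {x | x ≠ 0 → a ∈ I.1}
  zero_mem' := fun h => absurd rfl h
  add_mem' := by
    intro x y hx hy h
    by_cases h0 : x = 0
    · exact hy (fun h1 => h (by simp [h0, h1]))
    · exact hx h0
  smul_mem' := by
    intro c x hx h
    exact hx (fun h0 => h (by simp [h0]))

/-- The structure map of the interval module of `I` from an arbitrary point to `b`: it is the
identity of `K` on points of `I`, and `0` as soon as one of the two points is not in `I`. -/
def intervalMap (K : Type u) [Field K] {P : Type} [Preorder P] (I : Intvl P) (a b : P) :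
    intervalFiber K I a →ₗ[K] intervalFiber K I b where
  toFun x := open Classical in
    ⟨if b ∈ I.1 then (x : K) else 0, by
      intro h
      by_contra hb
      exact h (if_neg hb)⟩
  map_add' := by
    intro x y
    apply Subtype.ext
    by_cases hb : b ∈ I.1 <;> simp [hb]
  map_smul' := by
    intro c x
    apply Subtype.ext
    by_cases hb : b ∈ I.1 <;> simp [hb]

/-- The interval module of `I`. It is the zero module if `I` is empty. -/
def intervalModule (K : Type u) [Field K] {P : Type} [Preorder P] (I : Intvl P) :
    PersMod K P where
  obj a := ModuleCat.of K (intervalFiber K I a)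
  map {a b} _ := ModuleCat.ofHom (intervalMap K I a b)
  map_id a := by
    ext x
    classical
    change (if a ∈ I.1 then (x : K) else 0) = (x : K)
    split_ifs with h
    · rfl
    · by_contra hx
      exact h (x.2 (fun h0 => hx h0.symm))
  map_comp {a b c} f g := by
    ext x
    classical
    change (if c ∈ I.1 then (x : K) else 0) =
      (if c ∈ I.1 then (if b ∈ I.1 then (x : K) else 0) else 0)
    by_cases hc : c ∈ I.1
    · by_cases hb : b ∈ I.1
      · simp [hc, hb]
      · have hx : (x : K) = 0 := by
          by_contra hx
          exact hb (I.2.out (x.2 hx) hc ⟨leOfHom f, leOfHom g⟩)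
        simp [hx]
    · simp [hc]

/-- The infimum of `‖{μ(M_a △ N_a)}‖_p` over all `M ≅ ∐ M_a` and `N ≅ ∐ N_a` in which every `M_a`
and `N_a` is an interval module or zero, the latter being given by the empty interval. -/
def intervalWasserstein {K : Type u} [Field K] {P : Type} [Preorder P] [MeasurableSpace P]
    (p : ℝ≥0∞) (μ : Measure P) (M N : PersMod K P) : ℝ≥0∞ :=
  ⨅ (A : Type u) (I : A → Intvl P) (J : A → Intvl P)
    (_ : Nonempty (M ≅ ∐ fun a => intervalModule K (I a)))
    (_ : Nonempty (N ≅ ∐ fun a => intervalModule K (J a))),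
    pNorm p (fun a => μ (symmDiff (I a).1 (J a).1))

/-- A multiset of points of `[-∞,∞]²`, given as an indexed family. -/
structure Diagram where
  idx : Type u
  pt : idx → EReal × EReal

/-- `D` is the persistence diagram of `M`, with respect to the assignment `x` of a point of
`[-∞,∞]²` to each interval: `M ≅ ∐ I_j` with nonempty intervals `I_j`, and `D = {x(I_j)}`. -/
def IsDiagramOf {K : Type u} [Field K] {P : Type} [Preorder P]
    (x : Set P → EReal × EReal) (M : PersMod K P) (D : Diagram.{u}) : Prop :=
  ∃ I : D.idx → Intvl P, (∀ j, (I j).1.Nonempty) ∧ (∀ j, D.pt j = x (I j).1) ∧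
    Nonempty (M ≅ ∐ fun j => intervalModule K (I j))

/-- `x(I) = (inf I, sup I)` for intervals of a subset of `ℝ`. -/
def realPoint {P : Set ℝ} (I : Set P) : EReal × EReal :=
  (⨅ a ∈ I, (((a : ℝ)) : EReal), ⨆ a ∈ I, (((a : ℝ)) : EReal))

/-- `x(I) = (inf I, 1 + sup I)` for intervals of a subset of `ℤ`: these are the end points of the
half-open real interval which is the union of the `[a, a + 1)` with `a ∈ I`. -/
def intPoint {P : Set ℤ} (I : Set P) : EReal × EReal :=
  (⨅ a ∈ I, ((((a : ℤ) : ℝ)) : EReal), ⨆ a ∈ I, ((((a : ℤ) : ℝ) + 1 : ℝ) : EReal))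

/-- `|s - t|` on `[-∞,∞]`, with `|∞ - ∞| = |(-∞) - (-∞)| = 0`. -/
def extDist (s t : EReal) : ℝ≥0∞ :=
  open Classical in if s = t then 0 else (s - t).abs

/-- The distance on `[-∞,∞]²` given by the `1`-norm. -/
def ptDist (x y : EReal × EReal) : ℝ≥0∞ :=
  extDist x.1 y.1 + extDist x.2 y.2

/-- The distance to the diagonal of `[-∞,∞]²`. -/
def diagDist (x : EReal × EReal) : ℝ≥0∞ :=
  ⨅ z : EReal, ptDist x (z, z)

/-- The classical `p`-Wasserstein distance between persistence diagrams: the infimum over all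
matchings, that is, all injections `φ : C → E.idx` with `C ⊆ D.idx`. -/
def diagWasserstein (p : ℝ≥0∞) (D E : Diagram.{u}) : ℝ≥0∞ :=
  ⨅ (C : Set D.idx) (φ : C → E.idx) (_ : Function.Injective φ),
    pNorm p ![pNorm p (fun c : C => ptDist (D.pt c) (E.pt (φ c))),
      pNorm p (fun a : (Cᶜ : Set D.idx) => diagDist (D.pt a)),
      pNorm p (fun b : ((Set.range φ)ᶜ : Set E.idx) => diagDist (E.pt b))]

end AlgWass

end

/-! The first equality rests on two facts. The first is Azumaya's theorem for sums of interval
modules. Endomorphisms of an interval module are scalars, so a nonempty interval has a local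
endomorphism ring. Conversely, a summand with local endomorphism ring of a sum of interval modules
is isomorphic to one of them (`exists_iso_of_retract_decomp`). Hence the decompositions that define
the algebraic distance are, up to isomorphism, exactly the interval decompositions.

The second fact is that `d_μ` between two interval modules is `μ (I ∆ J)`
(`zigzagDist_intervalModule`). The upper bound is an explicit zigzag of inclusions and quotients
through `I ∩ J`. For the lower bound, at a point where all kernels and cokernels of a zigzag vanish
the two end fibres are isomorphic, so over `I ∆ J` the total weight is at least one.

For the comparison with diagrams, the nonempty intervals of a decomposition are unique with
multiplicity (`exists_equiv_of_isDecomp`), so pairs of decompositions over a common index set amount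
to partial matchings, padded by empty intervals. A pair of disjoint intervals is turned into two
unmatched points; this does not increase the cost, because `μ (I ∆ J) = μ I + μ J` and `a ^ p + b ^
p ≤ (a + b) ^ p`.

When `P` has no gaps, each interval is realized up to a null set by the half-open real interval
between its diagram coordinates. Then `μ I` is the distance to the diagonal, and `μ (I ∆ J)` is at
most the distance of the two points, with equality when `I` and `J` meet. -/

namespace AlgWass

/-! ### Direct sums of persistence modules, fibre by fibre -/

section Modules

variable {K : Type u} [Field K] {P : Type} [Preorder P]

/-- The linear map which a morphism of persistence modules induces at a point. -/
def fiberMap {M N : PersMod K P} (f : M ⟶ N) (c : P) : M.obj c →ₗ[K] N.obj c := (f.app c).hom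

/-- The structure map of a persistence module. -/
def transport (M : PersMod K P) {c d : P} (h : c ≤ d) : M.obj c →ₗ[K] M.obj d :=
  (M.map (homOfLE h)).hom

theorem hom_ext_fiber {M N : PersMod K P} {f g : M ⟶ N}
    (h : ∀ c x, fiberMap f c x = fiberMap g c x) : f = g := by
  ext c x
  exact h c x

@[simp] theorem fiberMap_id (M : PersMod K P) (c : P) (x : M.obj c) :
    fiberMap (𝟙 M) c x = x := rfl

@[simp] theorem fiberMap_comp {L M N : PersMod K P} (f : L ⟶ M) (g : M ⟶ N) (c : P)
    (x : L.obj c) : fiberMap (f ≫ g) c x = fiberMap g c (fiberMap f c x) := rfl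

@[simp] theorem fiberMap_zero (M N : PersMod K P) (c : P) :
    fiberMap (0 : M ⟶ N) c = 0 := rfl

@[simp] theorem fiberMap_add {M N : PersMod K P} (f g : M ⟶ N) (c : P) :
    fiberMap (f + g) c = fiberMap f c + fiberMap g c := rfl

@[simp] theorem fiberMap_sub {M N : PersMod K P} (f g : M ⟶ N) (c : P) :
    fiberMap (f - g) c = fiberMap f c - fiberMap g c := by
  refine eq_sub_of_add_eq ?_
  rw [← fiberMap_add, sub_add_cancel]

theorem fiberMap_sum {M N : PersMod K P} {A : Type*} (F : Finset A) (f : A → (M ⟶ N)) (c : P)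
    (x : M.obj c) : fiberMap (∑ a ∈ F, f a) c x = ∑ a ∈ F, fiberMap (f a) c x := by
  classical
  induction F using Finset.induction_on with
  | empty => simp
  | insert a s ha ih => simp [Finset.sum_insert ha, ih]

theorem fiberMap_transport {M N : PersMod K P} (f : M ⟶ N) {c d : P} (h : c ≤ d) (x : M.obj c) :
    fiberMap f d (transport M h x) = transport N h (fiberMap f c x) := by
  have := f.naturality (homOfLE h)
  exact congrArg (fun g => g.hom x) this

/-- A family of submodule inclusions and projections which exhibits `M` as the direct sum
of the modules `X a`. -/
structure IsDecomp (M : PersMod K P) {A : Type u} (X : A → PersMod K P)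
    (ι : ∀ a, X a ⟶ M) (π : ∀ a, M ⟶ X a) : Prop where
  ι_π : ∀ a, ι a ≫ π a = 𝟙 (X a)
  ι_π_ne : ∀ a b, a ≠ b → ι a ≫ π b = 0
  exists_sum : ∀ c (x : M.obj c), ∃ F : Finset A, x = ∑ a ∈ F, fiberMap (ι a) c (fiberMap (π a) c x)

theorem IsDecomp.exists_sum_superset {M : PersMod K P} {A : Type u} {X : A → PersMod K P}
    {ι : ∀ a, X a ⟶ M} {π : ∀ a, M ⟶ X a} (h : IsDecomp M X ι π) (c : P) (x : M.obj c) :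
    ∃ F : Finset A, (∀ a ∉ F, fiberMap (π a) c x = 0) ∧
      x = ∑ a ∈ F, fiberMap (ι a) c (fiberMap (π a) c x) := by
  obtain ⟨F, hF⟩ := h.exists_sum c x
  refine ⟨F, fun b hb => ?_, hF⟩
  rw [hF, map_sum]
  refine Finset.sum_eq_zero fun a ha => ?_
  rw [← fiberMap_comp, h.ι_π_ne a b (fun e => hb (e ▸ ha))]
  rfl

theorem IsDecomp.of_iso {M N : PersMod K P} {A : Type u} {X : A → PersMod K P}
    {ι : ∀ a, X a ⟶ M} {π : ∀ a, M ⟶ X a} (h : IsDecomp M X ι π) (e : N ≅ M) :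
    IsDecomp N X (fun a => ι a ≫ e.inv) (fun a => e.hom ≫ π a) where
  ι_π a := by simp [h.ι_π]
  ι_π_ne a b hab := by simp [h.ι_π_ne a b hab]
  exists_sum c x := by
    obtain ⟨F, hF⟩ := h.exists_sum c (fiberMap e.hom c x)
    refine ⟨F, ?_⟩
    have := congrArg (fiberMap e.inv c) hF
    rw [← fiberMap_comp, e.hom_inv_id, map_sum] at this
    exact this

/-- Evaluation at `c` preserves colimits, so a linear map out of the fibre is determined on the
summands. The quotient map by the span kills every summand, hence is zero. -/
theorem span_ι_eq_top {A : Type u} (X : A → PersMod K P) (c : P) :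
    Submodule.span K (⋃ a, Set.range (fiberMap (Sigma.ι X a) c)) = ⊤ := by
  set S := Submodule.span K (⋃ a, Set.range (fiberMap (Sigma.ι X a) c)) with hS
  have hc := isColimitOfPreserves ((evaluation P (ModuleCat.{u} K)).obj c)
    (colimit.isColimit (Discrete.functor X))
  have key : (ModuleCat.ofHom S.mkQ : (∐ X).obj c ⟶ ModuleCat.of K ((∐ X).obj c ⧸ S)) = 0 := by
    refine hc.hom_ext fun a => ?_
    obtain ⟨a⟩ := a
    ext x
    change S.mkQ (fiberMap (Sigma.ι X a) c x) = 0
    rw [Submodule.mkQ_apply, Submodule.Quotient.mk_eq_zero]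
    exact Submodule.subset_span (Set.mem_iUnion.2 ⟨a, x, rfl⟩)
  rw [eq_top_iff]
  intro x _
  rw [← Submodule.Quotient.mk_eq_zero]
  exact congrArg (fun g => g.hom x) key

theorem isDecomp_sigma {A : Type u} [DecidableEq A] (X : A → PersMod K P) :
    IsDecomp (∐ X) X (Sigma.ι X) (Sigma.π X) where
  ι_π a := Sigma.ι_π_eq_id X a
  ι_π_ne a b h := Sigma.ι_π_of_ne X h
  exists_sum c x := by
    -- Asking for all larger finite sets lets the induction take unions when vectors are added.
    suffices h : ∃ F : Finset A, ∀ G, F ⊆ G →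
        x = ∑ a ∈ G, fiberMap (Sigma.ι X a) c (fiberMap (Sigma.π X a) c x) by
      obtain ⟨F, hF⟩ := h
      exact ⟨F, hF F subset_rfl⟩
    have hx : x ∈ Submodule.span K (⋃ a, Set.range (fiberMap (Sigma.ι X a) c)) := by
      rw [span_ι_eq_top]; trivial
    induction hx using Submodule.span_induction with
    | mem x hx =>
      obtain ⟨a, y, rfl⟩ := Set.mem_iUnion.1 hx
      refine ⟨{a}, fun G hG => ?_⟩
      rw [Finset.sum_eq_single a]
      · rw [← fiberMap_comp _ (Sigma.π X a), Sigma.ι_π_eq_id]; rfl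
      · intro b _ hb
        rw [← fiberMap_comp _ (Sigma.π X b), Sigma.ι_π_of_ne X hb.symm]
        simp
      · intro h
        exact absurd (hG (Finset.mem_singleton_self a)) h
    | zero => exact ⟨∅, fun G _ => by simp⟩
    | add x y _ _ hx hy =>
      obtain ⟨F, hF⟩ := hx
      obtain ⟨F', hF'⟩ := hy
      refine ⟨F ∪ F', fun G hG => ?_⟩
      simp only [map_add, Finset.sum_add_distrib]
      rw [← hF G (Finset.union_subset_left hG), ← hF' G (Finset.union_subset_right hG)]
    | smul r x _ hx =>
      obtain ⟨F, hF⟩ := hx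
      refine ⟨F, fun G hG => ?_⟩
      simp only [map_smul, ← Finset.smul_sum]
      rw [← hF G hG]

theorem exists_isDecomp {M : PersMod K P} {A : Type u} {X : A → PersMod K P}
    (e : Nonempty (M ≅ ∐ X)) :
    ∃ (ι : ∀ a, X a ⟶ M) (π : ∀ a, M ⟶ X a), IsDecomp M X ι π :=
  open Classical in
  let ⟨e⟩ := e
  ⟨_, _, (isDecomp_sigma X).of_iso e⟩

/-- Zero objects may be added to a coproduct. -/
theorem nonempty_iso_coprod_sum {A B : Type u} (Z : A ⊕ B → PersMod K P)
    (hZ : ∀ b, IsZero (Z (Sum.inr b))) : Nonempty ((∐ fun a => Z (Sum.inl a)) ≅ ∐ Z) := by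
  let f : (∐ fun a => Z (Sum.inl a)) ⟶ ∐ Z := Sigma.desc fun a => Sigma.ι Z (Sum.inl a)
  let g' : ∀ s, Z s ⟶ ∐ fun a => Z (Sum.inl a)
    | Sum.inl a => Sigma.ι (fun a => Z (Sum.inl a)) a
    | Sum.inr _ => 0
  let g : (∐ Z) ⟶ ∐ fun a => Z (Sum.inl a) := Sigma.desc g'
  have hf : ∀ a, Sigma.ι (fun a => Z (Sum.inl a)) a ≫ f = Sigma.ι Z (Sum.inl a) :=
    fun a => Sigma.ι_desc _ _
  have hg : ∀ a, Sigma.ι Z (Sum.inl a) ≫ g = Sigma.ι (fun a => Z (Sum.inl a)) a :=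
    fun a => Sigma.ι_desc _ _
  refine ⟨⟨f, g, ?_, ?_⟩⟩
  · refine Sigma.hom_ext _ _ fun a => ?_
    rw [← Category.assoc, hf, hg, Category.comp_id]
  · refine Sigma.hom_ext _ _ ?_
    rintro (a | b)
    · rw [← Category.assoc, hg, hf, Category.comp_id]
    · exact (hZ b).eq_of_src _ _

theorem nonempty_iso_coprod_reindex {A B : Type u} (e : A ≃ B) (X : A → PersMod K P)
    (Y : B → PersMod K P) (h : ∀ a, Y (e a) = X a) : Nonempty ((∐ X) ≅ ∐ Y) :=
  ⟨Sigma.whiskerEquiv e fun a => eqToIso (h a)⟩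

end Modules

/-! ### Interval modules: endomorphisms, local summands, uniqueness of decompositions -/

section Intervals

variable {K : Type u} [Field K] {P : Type} [LinearOrder P]

/-- The generator of the fibre of an interval module. -/
def intervalOne (K : Type u) [Field K] {I : Intvl P} {c : P} (h : c ∈ I.1) :
    (intervalModule K I).obj c := (⟨1, fun _ => h⟩ : intervalFiber K I c)

/-- The elements of the fibres of an interval module are scalars. -/
def intervalCoord (K : Type u) [Field K] (I : Intvl P) (c : P) :
    (intervalModule K I).obj c →ₗ[K] K := (intervalFiber K I c).subtype

theorem intervalCoord_injective (I : Intvl P) (c : P) :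
    Function.Injective (intervalCoord K I c) := Subtype.val_injective

theorem mem_of_intervalCoord_ne_zero {I : Intvl P} {c : P} {x : (intervalModule K I).obj c}
    (h : intervalCoord K I c x ≠ 0) : c ∈ I.1 :=
  Subtype.property (p := fun y => y ∈ intervalFiber K I c) x h

theorem intervalModule_mem_of_ne_zero {I : Intvl P} {c : P} {x : (intervalModule K I).obj c}
    (h : x ≠ 0) : c ∈ I.1 := by
  refine mem_of_intervalCoord_ne_zero (x := x) fun h0 => h ?_
  exact intervalCoord_injective I c (by simpa using h0)

@[simp] theorem intervalCoord_one {I : Intvl P} {c : P} (h : c ∈ I.1) :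
    intervalCoord K I c (intervalOne K h) = 1 := rfl

theorem intervalCoord_transport {I : Intvl P} {c d : P} (h : c ≤ d) (hd : d ∈ I.1)
    (x : (intervalModule K I).obj c) :
    intervalCoord K I d (transport _ h x) = intervalCoord K I c x := by
  classical
  exact if_pos hd

theorem eq_smul_intervalOne {I : Intvl P} {c : P} (h : c ∈ I.1) (x : (intervalModule K I).obj c) :
    x = intervalCoord K I c x • intervalOne K h := by
  apply intervalCoord_injective
  simp

theorem transport_intervalOne {I : Intvl P} {c d : P} (h : c ≤ d) (hc : c ∈ I.1) (hd : d ∈ I.1) :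
    transport _ h (intervalOne K hc) = intervalOne K hd := by
  apply intervalCoord_injective
  rw [intervalCoord_transport h hd]
  simp

theorem intervalHom_coord_const {I J : Intvl P} (f : intervalModule K I ⟶ intervalModule K J)
    {c d : P} (hc : c ∈ I.1) (hd : d ∈ I.1) (hcJ : c ∈ J.1) (hdJ : d ∈ J.1) :
    intervalCoord K J c (fiberMap f c (intervalOne K hc)) =
      intervalCoord K J d (fiberMap f d (intervalOne K hd)) := by
  wlog h : c ≤ d generalizing c d
  · exact (this hd hc hdJ hcJ (le_of_not_ge h)).symm
  rw [← transport_intervalOne h hc hd, fiberMap_transport, intervalCoord_transport h hdJ]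

/-- Endomorphisms of interval modules are scalars. -/
theorem exists_intervalEnd_apply (I : Intvl P) (f : intervalModule K I ⟶ intervalModule K I) :
    ∃ r : K, ∀ c x, fiberMap f c x = r • x := by
  by_cases hI : I.1.Nonempty
  · obtain ⟨c, hc⟩ := hI
    refine ⟨intervalCoord K I c (fiberMap f c (intervalOne K hc)), fun d x => ?_⟩
    by_cases hd : d ∈ I.1
    · rw [intervalHom_coord_const f hc hd hc hd]
      apply intervalCoord_injective
      conv_lhs => rw [eq_smul_intervalOne hd x]
      simp [mul_comm]
    · have hx : x = 0 := by
        by_contra hx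
        exact hd (intervalModule_mem_of_ne_zero hx)
      simp [hx]
  · refine ⟨0, fun d x => ?_⟩
    have hx : x = 0 := by
      by_contra hx
      exact hI ⟨d, intervalModule_mem_of_ne_zero hx⟩
    simp [hx]

theorem intervalModule_isZero {I : Intvl P} (hI : ¬ I.1.Nonempty) : IsZero (intervalModule K I) := by
  rw [IsZero.iff_id_eq_zero]
  refine hom_ext_fiber fun c x => ?_
  by_contra hx
  exact hI ⟨c, intervalModule_mem_of_ne_zero hx⟩

theorem isLocalRing_end_intervalModule {I : Intvl P} (hI : I.1.Nonempty) :
    IsLocalRing (End (intervalModule K I)) := by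
  have hnt : Nontrivial (End (intervalModule K I)) := by
    refine ⟨⟨𝟙 _, 0, fun h => ?_⟩⟩
    obtain ⟨c, hc⟩ := hI
    have := congrArg (fun g => intervalCoord K I c (fiberMap g c (intervalOne K hc))) h
    simp at this
  refine IsLocalRing.of_isUnit_or_isUnit_one_sub_self fun f => ?_
  obtain ⟨r, hr⟩ := exists_intervalEnd_apply I f
  by_cases h0 : r = 0
  · right
    have : f = 0 := hom_ext_fiber fun c x => by rw [hr, h0]; simp
    rw [this, sub_zero]
    exact isUnit_one
  · left
    have hinj : ∀ c, IsIso (f.app c) := by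
      intro c
      rw [ConcreteCategory.isIso_iff_bijective]
      constructor
      · intro x y hxy
        change fiberMap f c x = fiberMap f c y at hxy
        rw [hr, hr] at hxy
        exact smul_right_injective _ h0 hxy
      · intro y
        refine ⟨r⁻¹ • y, ?_⟩
        change fiberMap f c (r⁻¹ • y) = y
        rw [hr, smul_inv_smul₀ h0]
    have : IsIso f := NatIso.isIso_of_isIso_app f
    exact (isUnit_iff_isIso f).2 this

/-- The composite is a scalar. Nonzero at one point, it is nonzero at every point of `I`, and there
it factors through the fibre of `J`. -/
theorem subset_of_comp_ne_zero {I J : Intvl P} (f : intervalModule K I ⟶ intervalModule K J)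
    (g : intervalModule K J ⟶ intervalModule K I) {c : P} {x : (intervalModule K I).obj c}
    (h : fiberMap g c (fiberMap f c x) ≠ 0) : I.1 ⊆ J.1 := by
  intro d hd
  have hc := intervalModule_mem_of_ne_zero h
  obtain ⟨r, hr⟩ := exists_intervalEnd_apply I (f ≫ g)
  have hr0 : r ≠ 0 := by
    rintro rfl
    apply h
    rw [← fiberMap_comp, hr, zero_smul]
  have h1 : fiberMap g d (fiberMap f d (intervalOne K hd)) ≠ 0 := by
    rw [← fiberMap_comp, hr]
    intro h0
    have := congrArg (intervalCoord K I d) h0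
    simp at this
    exact hr0 this
  refine intervalModule_mem_of_ne_zero (x := fiberMap f d (intervalOne K hd)) fun h0 => ?_
  rw [h0, map_zero] at h1
  exact h1 rfl

theorem eq_of_comp_ne_zero {I J : Intvl P} (f : intervalModule K I ⟶ intervalModule K J)
    (g : intervalModule K J ⟶ intervalModule K I) {c : P} {x : (intervalModule K I).obj c}
    (h : fiberMap g c (fiberMap f c x) ≠ 0) : I = J := by
  refine Subtype.ext (Set.Subset.antisymm (subset_of_comp_ne_zero f g h)
    (subset_of_comp_ne_zero g f (c := c) (x := fiberMap f c x) ?_))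
  obtain ⟨r, hr⟩ := exists_intervalEnd_apply I (f ≫ g)
  rw [← fiberMap_comp, hr] at h
  rw [← fiberMap_comp f g, hr, map_smul]
  intro h0
  rcases smul_eq_zero.1 h0 with h0 | h0
  · exact h (by rw [h0, zero_smul])
  · have : r • x = 0 := by rw [← hr, fiberMap_comp, h0, map_zero]
    exact h this

theorem fiberMap_comp_eq_zero {I I' J : Intvl P} (hI : I = I') (hJ : I ≠ J)
    (f : intervalModule K I ⟶ intervalModule K J) (g : intervalModule K J ⟶ intervalModule K I')
    (c : P) (x : (intervalModule K I).obj c) : fiberMap g c (fiberMap f c x) = 0 := by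
  subst hI
  by_contra h
  exact hJ (eq_of_comp_ne_zero f g h)

/-- A retract of an interval module is zero or isomorphic to the interval module. -/
theorem iso_intervalModule_of_retract {I : Intvl P} {X : PersMod K P} (hX : ¬ IsZero X)
    (s : X ⟶ intervalModule K I) (r : intervalModule K I ⟶ X) (h : s ≫ r = 𝟙 X) :
    Nonempty (X ≅ intervalModule K I) := by
  obtain ⟨t, ht⟩ := exists_intervalEnd_apply I (r ≫ s)
  have h1 : ∀ c x, t • fiberMap s c x = fiberMap s c x := by
    intro c x
    rw [← ht, fiberMap_comp, ← fiberMap_comp s r, h, fiberMap_id]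
  -- The scalar `t` acts as the identity on the image of `s`; if `t ≠ 1`, this image would be zero
  -- and `X` with it.
  have ht1 : t = 1 := by
    by_contra h0
    apply hX
    rw [IsZero.iff_id_eq_zero, ← h]
    refine hom_ext_fiber fun c x => ?_
    have : (t - 1) • fiberMap s c x = 0 := by rw [sub_smul, h1, one_smul, sub_self]
    rcases smul_eq_zero.1 this with h2 | h2
    · exact absurd (sub_eq_zero.1 h2) h0
    · rw [fiberMap_comp, h2]; simp
  refine ⟨⟨s, r, h, hom_ext_fiber fun c x => ?_⟩⟩
  rw [ht, ht1, one_smul, fiberMap_id]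

theorem exists_isUnit_of_isUnit_sum {R : Type*} [Ring R] [IsLocalRing R] {A : Type*}
    {F : Finset A} {e : A → R} (h : IsUnit (∑ a ∈ F, e a)) : ∃ a ∈ F, IsUnit (e a) := by
  classical
  induction F using Finset.induction_on with
  | empty => exact absurd (by simp at h) (not_isUnit_zero (M₀ := R))
  | insert a s ha ih =>
    obtain ⟨u, hu⟩ := h
    rw [Finset.sum_insert ha] at hu
    have h1 : (↑u⁻¹ : R) * e a + ↑u⁻¹ * ∑ a ∈ s, e a = 1 := by
      rw [← mul_add, ← hu, Units.inv_mul]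
    rcases IsLocalRing.isUnit_or_isUnit_of_add_one h1 with h2 | h2
    · exact ⟨a, Finset.mem_insert_self a s, (Units.isUnit_units_mul _ _).1 h2⟩
    · obtain ⟨b, hb, hb'⟩ := ih ((Units.isUnit_units_mul _ _).1 h2)
      exact ⟨b, Finset.mem_insert_of_mem hb, hb'⟩

/-- A summand with local endomorphism ring of a direct sum of interval modules is one of these
interval modules. -/
theorem exists_iso_of_retract_decomp {M X : PersMod K P} {A : Type u} {I : A → Intvl P}
    {ι : ∀ a, intervalModule K (I a) ⟶ M} {π : ∀ a, M ⟶ intervalModule K (I a)}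
    (hM : IsDecomp M (fun a => intervalModule K (I a)) ι π) [IsLocalRing (End X)]
    (s : X ⟶ M) (r : M ⟶ X) (h : s ≫ r = 𝟙 X) :
    ∃ a, Nonempty (X ≅ intervalModule K (I a)) := by
  have hX : ¬ IsZero X := by
    intro h0
    exact one_ne_zero (α := End X) ((IsZero.iff_id_eq_zero X).1 h0)
  have hx : ∃ c, ∃ x : X.obj c, x ≠ 0 := by
    by_contra! hx
    exact hX ((IsZero.iff_id_eq_zero X).2 (hom_ext_fiber fun c x => by simp [hx c x]))
  obtain ⟨c, x, hx⟩ := hx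
  obtain ⟨F, hF⟩ := hM.exists_sum c (fiberMap s c x)
  let e : A → End X := fun a => s ≫ π a ≫ ι a ≫ r
  have hsum : fiberMap (∑ a ∈ F, e a : X ⟶ X) c x = x := by
    rw [fiberMap_sum]
    have := congrArg (fiberMap r c) hF
    rw [← fiberMap_comp, h, map_sum] at this
    exact this.symm
  -- The finite sum fixes `x ≠ 0`, so one minus it is not invertible; locality makes the sum itself
  -- a unit.
  have hunit : IsUnit (∑ a ∈ F, e a) := by
    rcases IsLocalRing.isUnit_or_isUnit_of_add_one (add_sub_cancel (∑ a ∈ F, e a) 1) with hu | hu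
    · exact hu
    · exfalso
      obtain ⟨v, hv⟩ := hu.exists_left_inv
      apply hx
      have := congrArg (fun g : X ⟶ X => fiberMap g c x) hv
      change fiberMap v c (fiberMap (𝟙 X - (show X ⟶ X from ∑ a ∈ F, e a)) c x) = x at this
      rw [← this, fiberMap_sub, LinearMap.sub_apply, hsum, fiberMap_id, sub_self, map_zero]
  obtain ⟨a, _, ha⟩ := exists_isUnit_of_isUnit_sum hunit
  obtain ⟨v, hv⟩ := ha.exists_left_inv
  refine ⟨a, iso_intervalModule_of_retract hX (s ≫ π a) (ι a ≫ r ≫ v) ?_⟩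
  change (s ≫ π a ≫ ι a ≫ r) ≫ v = 𝟙 X at hv
  simpa using hv

open Cardinal in
-- At a point of `T`, the generators of the `T`-summands of the first decomposition stay independent
-- after projection to the `T`-summands of the second. Indeed, let `y` be a combination that
-- projects to zero, and expand it in the second decomposition. The summands equal to `T` contribute
-- nothing, and the others contribute maps `T → J b → T` with `J b ≠ T`, which vanish. So every
-- coefficient of `y` is zero. Comparing with the dimension also covers infinite multiplicities.
theorem mk_fiber_le_of_isDecomp {M : PersMod K P} {A B : Type u} {I : A → Intvl P}
    {J : B → Intvl P}
    {ι : ∀ a, intervalModule K (I a) ⟶ M} {π : ∀ a, M ⟶ intervalModule K (I a)}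
    (hA : IsDecomp M (fun a => intervalModule K (I a)) ι π)
    {ι' : ∀ a, intervalModule K (J a) ⟶ M} {π' : ∀ a, M ⟶ intervalModule K (J a)}
    (hB : IsDecomp M (fun a => intervalModule K (J a)) ι' π')
    (T : Intvl P) (hT : T.1.Nonempty) : #{a // I a = T} ≤ #{b // J b = T} := by
  classical
  obtain ⟨c, hc⟩ := hT
  let H : M.obj c →ₗ[K] ({b // J b = T} →₀ K) :=
    { toFun := fun x => Finsupp.ofSupportFinite
        (fun b => intervalCoord K (J b.1) c (fiberMap (π' b.1) c x)) (by
          obtain ⟨F, hF, -⟩ := hB.exists_sum_superset c x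
          refine (F.finite_toSet.preimage (Subtype.val_injective.injOn)).subset fun b hb => ?_
          by_contra hbF
          exact hb (by simp [hF b.1 hbF]))
      map_add' := fun x y => by ext b; simp [Finsupp.ofSupportFinite_coe]
      map_smul' := fun r x => by ext b; simp [Finsupp.ofSupportFinite_coe] }
  have hH : ∀ x b, H x b = intervalCoord K (J b.1) c (fiberMap (π' b.1) c x) := fun x b => rfl
  let v : {a // I a = T} → M.obj c := fun a =>
    fiberMap (ι a.1) c (intervalOne K (a.2.symm ▸ hc : c ∈ (I a.1).1))
  have hli : LinearIndependent K (fun a => H (v a)) := by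
    rw [linearIndependent_iff']
    intro s g hg a ha
    let y := ∑ a ∈ s, g a • v a
    have hy : H y = 0 := by rw [← hg]; simp [y]
    have h1 : ∀ b, J b = T → fiberMap (π' b) c y = 0 := fun b hb =>
      intervalCoord_injective _ _ (by rw [← hH y ⟨b, hb⟩, hy]; simp)
    have h2 : fiberMap (π a.1) c y = 0 := by
      obtain ⟨F, hF⟩ := hB.exists_sum c y
      rw [hF, map_sum]
      refine Finset.sum_eq_zero fun b _ => ?_
      by_cases hb : J b = T
      · rw [h1 b hb]; simp
      · simp only [y, map_sum, map_smul]
        refine Finset.sum_eq_zero fun a' _ => ?_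
        have := fiberMap_comp_eq_zero (a'.2.trans a.2.symm) (fun h => hb (h.symm.trans a'.2))
          (ι a'.1 ≫ π' b) (ι' b ≫ π a.1) c (intervalOne K (a'.2.symm ▸ hc : c ∈ (I a'.1).1))
        change g a' • fiberMap (ι' b ≫ π a.1) c (fiberMap (ι a'.1 ≫ π' b) c (intervalOne K _)) = 0
        rw [this, smul_zero]
    have h3 : fiberMap (π a.1) c y = g a • intervalOne K (a.2.symm ▸ hc : c ∈ (I a.1).1) := by
      simp only [y, map_sum, map_smul]
      rw [Finset.sum_eq_single_of_mem a ha]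
      · rw [← fiberMap_comp, hA.ι_π]; rfl
      · intro a' _ hne
        rw [← fiberMap_comp, hA.ι_π_ne a'.1 a.1 (fun h => hne (Subtype.ext h))]
        simp
    have h4 := congrArg (intervalCoord K (I a.1) c) (h3.symm.trans h2)
    simpa using h4
  have := hli.cardinal_le_rank
  rwa [rank_finsupp_self'] at this

/-- The nonempty intervals of two interval decompositions are the same. -/
theorem exists_equiv_of_isDecomp {M : PersMod K P} {A B : Type u} {I : A → Intvl P}
    {J : B → Intvl P} (hA : Nonempty (M ≅ ∐ fun a => intervalModule K (I a)))
    (hB : Nonempty (M ≅ ∐ fun b => intervalModule K (J b))) (hne : ∀ a, (I a).1.Nonempty) :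
    ∃ σ : A ≃ {b // (J b).1.Nonempty}, ∀ a, J (σ a).1 = I a := by
  obtain ⟨ι, π, hA⟩ := exists_isDecomp hA
  obtain ⟨ι', π', hB⟩ := exists_isDecomp hB
  have key : ∀ T : Intvl P, Nonempty ({a // I a = T} ≃
      {b : {b // (J b).1.Nonempty} // J b.1 = T}) := by
    intro T
    by_cases hT : T.1.Nonempty
    · have h1 := Cardinal.eq.1 (le_antisymm (mk_fiber_le_of_isDecomp hA hB T hT)
        (mk_fiber_le_of_isDecomp hB hA T hT))
      obtain ⟨e⟩ := h1
      exact ⟨e.trans ⟨fun b => ⟨⟨b.1, b.2.symm ▸ hT⟩, b.2⟩, fun b => ⟨b.1.1, b.2⟩,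
        fun _ => rfl, fun _ => rfl⟩⟩
    · have : IsEmpty {a // I a = T} := ⟨fun a => hT (a.2 ▸ hne a.1)⟩
      have : IsEmpty {b : {b // (J b).1.Nonempty} // J b.1 = T} := ⟨fun b => hT (b.2 ▸ b.1.2)⟩
      exact ⟨Equiv.equivOfIsEmpty _ _⟩
  let e := fun T => (key T).some
  exact ⟨Equiv.ofFiberEquiv (g := fun b : {b // (J b).1.Nonempty} => J b.1) e,
    fun a => Equiv.ofFiberEquiv_map e a⟩

end Intervals
end AlgWass

namespace AlgWass

/-! ### Zigzags and their costs -/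

section Zigzags

variable {K : Type u} [Field K] {P : Type} [Preorder P]

theorem dimKer_eq_zero {M N : PersMod K P} {f : M ⟶ N} {a : P}
    (h : Function.Injective (fiberMap f a)) : dimKer f a = 0 := by
  have : LinearMap.ker (f.app a).hom = ⊥ := LinearMap.ker_eq_bot.2 h
  simp [dimKer, this]

theorem dimCoker_eq_zero {M N : PersMod K P} {f : M ⟶ N} {a : P}
    (h : Function.Surjective (fiberMap f a)) : dimCoker f a = 0 := by
  have : LinearMap.range (f.app a).hom = ⊤ := LinearMap.range_eq_top.2 h
  simp [dimCoker, this, rank_subsingleton']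

theorem eq_zero_of_toENat_lt_one {c : Cardinal} (h : ((Cardinal.toENat c : ℕ∞) : ℝ≥0∞) < 1) :
    c = 0 := by
  rw [← Cardinal.toENat_eq_zero]
  have : (Cardinal.toENat c : ℕ∞) < 1 := by exact_mod_cast h
  exact Order.lt_one_iff.1 this

theorem fiberMap_bijective_of_lt_one {M N : PersMod K P} {f : M ⟶ N} {a : P}
    (hk : dimKer f a < 1) (hc : dimCoker f a < 1) : Function.Bijective (fiberMap f a) := by
  constructor
  · have := eq_zero_of_toENat_lt_one hk
    rw [Submodule.rank_eq_zero] at this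
    exact LinearMap.ker_eq_bot.1 this
  · have := eq_zero_of_toENat_lt_one hc
    rw [rank_zero_iff, Submodule.Quotient.subsingleton_iff] at this
    exact LinearMap.range_eq_top.1 this

theorem fiberMap_bijective_of_iso {M N : PersMod K P} (e : M ≅ N) (a : P) :
    Function.Bijective (fiberMap e.hom a) := by
  refine Function.bijective_iff_has_inverse.2 ⟨fiberMap e.inv a, fun x => ?_, fun x => ?_⟩
  · rw [← fiberMap_comp, e.hom_inv_id, fiberMap_id]
  · rw [← fiberMap_comp, e.inv_hom_id, fiberMap_id]

variable [MeasurableSpace P]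

theorem Zigzag.exists_append {L M N : PersMod K P} (μ : Measure P) (γ : Zigzag L M)
    (δ : Zigzag M N) (hγ : γ.IsMeasurable) (hδ : δ.IsMeasurable) :
    ∃ ε : Zigzag L N, ε.IsMeasurable ∧ ε.cost μ = γ.cost μ + δ.cost μ := by
  induction γ with
  | nil M => exact ⟨δ, hδ, (zero_add _).symm⟩
  | fwd f γ ih =>
    obtain ⟨ε, h1, h2⟩ := ih δ hγ.2.2 hδ
    exact ⟨.fwd f ε, ⟨hγ.1, hγ.2.1, h1⟩, by simp only [Zigzag.cost, h2, add_assoc]⟩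
  | bwd f γ ih =>
    obtain ⟨ε, h1, h2⟩ := ih δ hγ.2.2 hδ
    exact ⟨.bwd f ε, ⟨hγ.1, hγ.2.1, h1⟩, by simp only [Zigzag.cost, h2, add_assoc]⟩

theorem zigzagDist_triangle (μ : Measure P) (L M N : PersMod K P) :
    zigzagDist μ L N ≤ zigzagDist μ L M + zigzagDist μ M N := by
  unfold zigzagDist
  simp only [ENNReal.iInf_add, ENNReal.add_iInf]
  refine le_iInf fun δ => le_iInf fun hδ => le_iInf fun γ => le_iInf fun hγ => ?_
  obtain ⟨ε, h1, h2⟩ := Zigzag.exists_append μ γ δ hγ hδ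
  exact iInf₂_le_of_le ε h1 h2.le

theorem zigzagDist_le_of_hom (μ : Measure P) {M N : PersMod K P} (f : M ⟶ N)
    (hk : Measurable (dimKer f)) (hc : Measurable (dimCoker f)) :
    zigzagDist μ M N ≤ ∫⁻ a, dimKer f a ∂μ + ∫⁻ a, dimCoker f a ∂μ :=
  iInf₂_le_of_le (.fwd f (.nil N)) ⟨hk, hc, trivial⟩ (by simp [Zigzag.cost])

theorem zigzagDist_le_of_hom' (μ : Measure P) {M N : PersMod K P} (f : M ⟶ N)
    (hk : Measurable (dimKer f)) (hc : Measurable (dimCoker f)) :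
    zigzagDist μ N M ≤ ∫⁻ a, dimKer f a ∂μ + ∫⁻ a, dimCoker f a ∂μ :=
  iInf₂_le_of_le (.bwd f (.nil M)) ⟨hk, hc, trivial⟩ (by simp [Zigzag.cost])

theorem zigzagDist_eq_zero_of_iso (μ : Measure P) {M N : PersMod K P} (e : M ≅ N) :
    zigzagDist μ M N = 0 := by
  have hk : dimKer e.hom = fun _ => 0 :=
    funext fun a => dimKer_eq_zero (fiberMap_bijective_of_iso e a).1
  have hc : dimCoker e.hom = fun _ => 0 :=
    funext fun a => dimCoker_eq_zero (fiberMap_bijective_of_iso e a).2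
  refine le_antisymm ((zigzagDist_le_of_hom μ e.hom ?_ ?_).trans ?_) zero_le
  · rw [hk]; exact measurable_const
  · rw [hc]; exact measurable_const
  · simp [hk, hc]

theorem zigzagDist_le_of_iso (μ : Measure P) {M M' N N' : PersMod K P} (e : M ≅ M') (e' : N ≅ N') :
    zigzagDist μ M N ≤ zigzagDist μ M' N' := by
  refine (zigzagDist_triangle μ M M' N).trans ?_
  rw [zigzagDist_eq_zero_of_iso μ e, zero_add]
  refine (zigzagDist_triangle μ M' N' N).trans ?_
  rw [zigzagDist_eq_zero_of_iso μ e'.symm, add_zero]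

/-- Take for `w` the sum of all kernel and cokernel dimensions. These are integers or infinite, so
`w a < 1` makes every arrow bijective at `a`. -/
theorem Zigzag.exists_weight {M N : PersMod K P} (μ : Measure P) (γ : Zigzag M N)
    (hγ : γ.IsMeasurable) : ∃ w : P → ℝ≥0∞, ∫⁻ a, w a ∂μ ≤ γ.cost μ ∧
      ∀ a, w a < 1 → Nonempty (M.obj a ≃ₗ[K] N.obj a) := by
  induction γ with
  | nil M => exact ⟨0, by simp, fun a _ => ⟨LinearEquiv.refl K _⟩⟩
  | fwd f γ ih =>
    obtain ⟨w, h1, h2⟩ := ih hγ.2.2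
    refine ⟨fun a => dimKer f a + dimCoker f a + w a, ?_, fun a ha => ?_⟩
    · refine (lintegral_add_left (hγ.1.add hγ.2.1) w).trans_le ?_
      rw [show dimKer f + dimCoker f = fun a => dimKer f a + dimCoker f a from rfl,
        lintegral_add_left hγ.1]
      exact add_le_add_right h1 _
    · obtain ⟨e⟩ := h2 a (lt_of_le_of_lt le_add_self ha)
      have h3 := lt_of_le_of_lt le_self_add ha
      exact ⟨(LinearEquiv.ofBijective (fiberMap f a) (fiberMap_bijective_of_lt_one
        (lt_of_le_of_lt le_self_add h3) (lt_of_le_of_lt le_add_self h3))).trans e⟩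
  | bwd f γ ih =>
    obtain ⟨w, h1, h2⟩ := ih hγ.2.2
    refine ⟨fun a => dimKer f a + dimCoker f a + w a, ?_, fun a ha => ?_⟩
    · refine (lintegral_add_left (hγ.1.add hγ.2.1) w).trans_le ?_
      rw [show dimKer f + dimCoker f = fun a => dimKer f a + dimCoker f a from rfl,
        lintegral_add_left hγ.1]
      exact add_le_add_right h1 _
    · obtain ⟨e⟩ := h2 a (lt_of_le_of_lt le_add_self ha)
      have h3 := lt_of_le_of_lt le_self_add ha
      exact ⟨(LinearEquiv.ofBijective (fiberMap f a) (fiberMap_bijective_of_lt_one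
        (lt_of_le_of_lt le_self_add h3) (lt_of_le_of_lt le_add_self h3))).symm.trans e⟩

end Zigzags

/-! ### The distance of interval modules and the first equality -/

section IntervalDistance

variable {K : Type u} [Field K] {P : Type} [LinearOrder P]

theorem intervalModule_subsingleton {I : Intvl P} {c : P} (h : c ∉ I.1) :
    Subsingleton ((intervalModule K I).obj c) := by
  refine subsingleton_of_forall_eq 0 fun x => ?_
  by_contra hx
  exact h (intervalModule_mem_of_ne_zero hx)

theorem rank_intervalModule_obj {I : Intvl P} {c : P} (h : c ∈ I.1) :
    Module.rank K ((intervalModule K I).obj c) = 1 := by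
  rw [LinearEquiv.rank_eq (LinearEquiv.ofBijective (intervalCoord K I c)
    ⟨intervalCoord_injective I c, fun r => ⟨r • intervalOne K h, by simp⟩⟩)]
  exact Module.rank_self K

/-- The morphism of interval modules which is the identity of `K` on the common points. -/
noncomputable def intervalHom (K : Type u) [Field K] (I J : Intvl P)
    (h : ∀ c d, c ≤ d → c ∈ I.1 → d ∈ J.1 → c ∈ J.1 ∧ d ∈ I.1) :
    intervalModule K I ⟶ intervalModule K J where
  app c := ModuleCat.ofHom (open Classical in
    { toFun := fun x => (⟨if c ∈ J.1 then intervalCoord K I c x else 0, by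
        intro h
        by_contra hb
        exact h (if_neg hb)⟩ : intervalFiber K J c)
      map_add' := by
        intro x y
        apply Subtype.ext
        by_cases hb : c ∈ J.1
        · simp only [hb, if_true]
          exact map_add (intervalCoord K I c) x y
        · simp [hb]
      map_smul' := by
        intro r x
        apply Subtype.ext
        by_cases hb : c ∈ J.1
        · simp only [hb, if_true]
          exact map_smul (intervalCoord K I c) r x
        · simp [hb] })
  naturality c d f := by
    ext x
    classical
    apply intervalCoord_injective
    change (if d ∈ J.1 then (if d ∈ I.1 then intervalCoord K I c x else 0) else 0) =
      (if d ∈ J.1 then (if c ∈ J.1 then intervalCoord K I c x else 0) else 0)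
    by_cases hd : d ∈ J.1
    · by_cases hx : intervalCoord K I c x = 0
      · simp [hx]
      · have := h c d (leOfHom f) (mem_of_intervalCoord_ne_zero hx) hd
        simp [this.1, this.2]
    · simp [hd]

theorem intervalCoord_intervalHom {I J : Intvl P}
    (h : ∀ c d, c ≤ d → c ∈ I.1 → d ∈ J.1 → c ∈ J.1 ∧ d ∈ I.1) {c : P} (hc : c ∈ J.1)
    (x : (intervalModule K I).obj c) :
    intervalCoord K J c (fiberMap (intervalHom K I J h) c x) = intervalCoord K I c x := by
  classical
  exact if_pos hc

theorem dimKer_intervalHom {I J : Intvl P}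
    (h : ∀ c d, c ≤ d → c ∈ I.1 → d ∈ J.1 → c ∈ J.1 ∧ d ∈ I.1) :
    dimKer (intervalHom K I J h) = (I.1 \ J.1).indicator 1 := by
  classical
  funext c
  by_cases hJ : c ∈ J.1
  · rw [Set.indicator_of_notMem (fun hc => hc.2 hJ)]
    refine dimKer_eq_zero fun x y hxy => ?_
    apply intervalCoord_injective
    rw [← intervalCoord_intervalHom h hJ, hxy, intervalCoord_intervalHom h hJ]
  · have := intervalModule_subsingleton (K := K) hJ
    by_cases hI : c ∈ I.1
    · rw [Set.indicator_of_mem (Set.mem_sdiff_of_mem hI hJ)]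
      have : LinearMap.ker ((intervalHom K I J h).app c).hom = ⊤ :=
        LinearMap.ker_eq_top.2 (LinearMap.ext fun x => Subsingleton.elim _ _)
      have h1 := (LinearEquiv.ofTop _ this).rank_eq.trans (rank_intervalModule_obj hI)
      simp [dimKer, h1]
    · rw [Set.indicator_of_notMem (fun hc => hI hc.1)]
      have := intervalModule_subsingleton (K := K) hI
      exact dimKer_eq_zero fun x y _ => Subsingleton.elim x y

theorem dimCoker_intervalHom {I J : Intvl P}
    (h : ∀ c d, c ≤ d → c ∈ I.1 → d ∈ J.1 → c ∈ J.1 ∧ d ∈ I.1) :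
    dimCoker (intervalHom K I J h) = (J.1 \ I.1).indicator 1 := by
  classical
  funext c
  by_cases hJ : c ∈ J.1
  · by_cases hI : c ∈ I.1
    · rw [Set.indicator_of_notMem (fun hc => hc.2 hI)]
      refine dimCoker_eq_zero fun y => ⟨intervalCoord K J c y • intervalOne K hI, ?_⟩
      apply intervalCoord_injective
      rw [intervalCoord_intervalHom h hJ]
      simp
    · rw [Set.indicator_of_mem (Set.mem_sdiff_of_mem hJ hI)]
      have := intervalModule_subsingleton (K := K) hI
      have h0 : ((intervalHom K I J h).app c).hom = 0 :=
        LinearMap.ext fun x => by rw [Subsingleton.elim x 0, map_zero, map_zero]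
      have h1 : Module.rank K (((intervalModule K J).obj c) ⧸
          LinearMap.range ((intervalHom K I J h).app c).hom) = 1 := by
        rw [h0, LinearMap.range_zero, (Submodule.quotEquivOfEqBot _ rfl).rank_eq,
          rank_intervalModule_obj hJ]
      simp [dimCoker, h1]
  · rw [Set.indicator_of_notMem (fun hc => hJ hc.1)]
    have := intervalModule_subsingleton (K := K) hJ
    exact dimCoker_eq_zero fun y => ⟨0, Subsingleton.elim _ _⟩

variable [MeasurableSpace P]

theorem lintegral_intervalHom (μ : Measure P) (hm : ∀ I : Intvl P, MeasurableSet I.1)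
    {I J : Intvl P} (h : ∀ c d, c ≤ d → c ∈ I.1 → d ∈ J.1 → c ∈ J.1 ∧ d ∈ I.1) :
    Measurable (dimKer (intervalHom K I J h)) ∧ Measurable (dimCoker (intervalHom K I J h)) ∧
      ∫⁻ a, dimKer (intervalHom K I J h) a ∂μ + ∫⁻ a, dimCoker (intervalHom K I J h) a ∂μ =
        μ (I.1 \ J.1) + μ (J.1 \ I.1) := by
  rw [dimKer_intervalHom, dimCoker_intervalHom, lintegral_indicator_one ((hm I).diff (hm J)),
    lintegral_indicator_one ((hm J).diff (hm I))]
  exact ⟨measurable_one.indicator ((hm I).diff (hm J)),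
    measurable_one.indicator ((hm J).diff (hm I)), rfl⟩

/-- The part of `I` above the points of `J`. -/
def upperPart (I J : Intvl P) : Intvl P :=
  ⟨{a | a ∈ I.1 ∧ ∃ b ∈ J.1, b ≤ a}, ⟨fun _ hx _ hy _ hz =>
    ⟨I.2.out hx.1 hy.1 hz, hx.2.imp fun _ hb => ⟨hb.1, hb.2.trans hz.1⟩⟩⟩⟩

/-- The upper part `U` is closed upwards in `I`, hence a submodule, and `J` is closed downwards in
`U`, hence a quotient of `U`. The two maps cost `μ (I \ U)` and `μ (U \ J)`. -/
theorem zigzagDist_subinterval (μ : Measure P) (hm : ∀ I : Intvl P, MeasurableSet I.1)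
    {I J : Intvl P} (hJ : J.1 ⊆ I.1) :
    zigzagDist μ (intervalModule K I) (intervalModule K J) ≤ μ (I.1 \ J.1) ∧
      zigzagDist μ (intervalModule K J) (intervalModule K I) ≤ μ (I.1 \ J.1) := by
  set U := upperPart I J with hU
  have hUI : U.1 ⊆ I.1 := fun a ha => ha.1
  have hJU : J.1 ⊆ U.1 := fun a ha => ⟨hJ ha, a, ha, le_rfl⟩
  have h1 : ∀ c d, c ≤ d → c ∈ U.1 → d ∈ I.1 → c ∈ I.1 ∧ d ∈ U.1 := fun c d hcd hc hd =>
    ⟨hc.1, hd, hc.2.imp fun _ hb => ⟨hb.1, hb.2.trans hcd⟩⟩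
  have h2 : ∀ c d, c ≤ d → c ∈ U.1 → d ∈ J.1 → c ∈ J.1 ∧ d ∈ U.1 := fun c d hcd hc hd =>
    let ⟨_, hb, hbc⟩ := hc.2
    ⟨J.2.out hb hd ⟨hbc, hcd⟩, hJU hd⟩
  obtain ⟨hk1, hc1, e1⟩ := lintegral_intervalHom (K := K) μ hm h1
  obtain ⟨hk2, hc2, e2⟩ := lintegral_intervalHom (K := K) μ hm h2
  rw [Set.sdiff_eq_empty.2 hUI, measure_empty, zero_add] at e1
  rw [Set.sdiff_eq_empty.2 hJU, measure_empty, add_zero] at e2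
  have hμ : μ (I.1 \ J.1) = μ (I.1 \ U.1) + μ (U.1 \ J.1) := by
    rw [← measure_union _ ((hm U).diff (hm J))]
    · congr 1
      ext a
      constructor
      · rintro ⟨ha, hb⟩
        by_cases h : a ∈ U.1
        · exact Or.inr ⟨h, hb⟩
        · exact Or.inl ⟨ha, h⟩
      · rintro (⟨ha, hb⟩ | ⟨ha, hb⟩)
        · exact ⟨ha, fun h => hb (hJU h)⟩
        · exact ⟨hUI ha, hb⟩
    · exact Set.disjoint_left.2 fun a ha hb => ha.2 hb.1
  rw [hμ, ← e1, ← e2]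
  constructor
  · exact (zigzagDist_triangle μ _ (intervalModule K U) _).trans
      (add_le_add (zigzagDist_le_of_hom' μ _ hk1 hc1) (zigzagDist_le_of_hom μ _ hk2 hc2))
  · refine (zigzagDist_triangle μ _ (intervalModule K U) _).trans ?_
    rw [add_comm]
    exact add_le_add (zigzagDist_le_of_hom μ _ hk1 hc1) (zigzagDist_le_of_hom' μ _ hk2 hc2)

/-- The distance of two interval modules is the measure of the symmetric difference. -/
theorem zigzagDist_intervalModule (μ : Measure P) (hm : ∀ I : Intvl P, MeasurableSet I.1)
    (I J : Intvl P) :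
    zigzagDist μ (intervalModule K I) (intervalModule K J) = μ (symmDiff I.1 J.1) := by
  apply le_antisymm
  -- For disjoint intervals `T` is empty and the zigzag passes through zero.
  · let T : Intvl P := ⟨I.1 ∩ J.1, I.2.inter J.2⟩
    refine (zigzagDist_triangle μ _ (intervalModule K T) _).trans ?_
    rw [Set.symmDiff_def, measure_union
      (Set.disjoint_left.2 fun a ha hb => ha.2 hb.1) ((hm J).diff (hm I))]
    refine add_le_add ((zigzagDist_subinterval μ hm Set.inter_subset_left).1.trans ?_)
      ((zigzagDist_subinterval μ hm Set.inter_subset_right).2.trans ?_)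
    · exact measure_mono fun a ha => ⟨ha.1, fun h => ha.2 ⟨ha.1, h⟩⟩
    · exact measure_mono fun a ha => ⟨ha.1, fun h => ha.2 ⟨h, ha.1⟩⟩
  · refine le_iInf fun γ => le_iInf fun hγ => ?_
    obtain ⟨w, h1, h2⟩ := γ.exists_weight μ hγ
    refine le_trans ?_ h1
    rw [← lintegral_indicator_one ((hm I).symmDiff (hm J))]
    refine lintegral_mono fun a => Set.indicator_le (fun a ha => ?_) a
    by_contra! hw
    obtain ⟨e⟩ := h2 a hw
    have hr := e.rank_eq
    rcases ha with ⟨hI, hJ⟩ | ⟨hJ, hI⟩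
    · have := intervalModule_subsingleton (K := K) hJ
      rw [rank_intervalModule_obj hI, rank_subsingleton'] at hr
      exact one_ne_zero hr
    · have := intervalModule_subsingleton (K := K) hI
      rw [rank_intervalModule_obj hJ, rank_subsingleton'] at hr
      exact zero_ne_one hr

theorem pNorm_mono {p : ℝ≥0∞} {A : Type*} {x y : A → ℝ≥0∞} (h : ∀ a, x a ≤ y a) :
    pNorm p x ≤ pNorm p y := by
  unfold pNorm
  split_ifs
  · exact iSup_mono h
  · exact ENNReal.rpow_le_rpow (ENNReal.tsum_le_tsum fun a => ENNReal.rpow_le_rpow (h a) (by simp))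
      (by simp)

/-- The algebraic Wasserstein distance of modules with interval decompositions. -/
theorem algWasserstein_eq_intervalWasserstein (p : ℝ≥0∞) (μ : Measure P)
    (hm : ∀ I : Intvl P, MeasurableSet I.1) {M N : PersMod K P} {B C : Type u}
    {I : B → Intvl P} {J : C → Intvl P}
    (hM : Nonempty (M ≅ ∐ fun b => intervalModule K (I b)))
    (hN : Nonempty (N ≅ ∐ fun c => intervalModule K (J c))) :
    algWasserstein p (zigzagDist μ) M N = intervalWasserstein p μ M N := by
  have hempty : (∅ : Set P).OrdConnected := Set.ordConnected_empty
  have key : ∀ {M : PersMod K P} {B : Type u} {I : B → Intvl P}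
      (_ : Nonempty (M ≅ ∐ fun b => intervalModule K (I b))) {A : Type u} {X : A → PersMod K P}
      (_ : Nonempty (M ≅ ∐ X)) (a : A) (_ : IsZero (X a) ∨ IsLocalRing (End (X a))),
      ∃ T : Intvl P, Nonempty (X a ≅ intervalModule K T) := by
    intro M B I hM A X hX a ha
    rcases ha with ha | ha
    · exact ⟨⟨∅, hempty⟩, ⟨ha.iso (intervalModule_isZero Set.not_nonempty_empty)⟩⟩
    · obtain ⟨ι, π, h⟩ := exists_isDecomp hM
      obtain ⟨ι', π', h'⟩ := exists_isDecomp hX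
      obtain ⟨b, hb⟩ := exists_iso_of_retract_decomp h (ι' a) (π' a) (h'.ι_π a)
      exact ⟨I b, hb⟩
  have hloc : ∀ I : Intvl P, IsZero (intervalModule K I) ∨
      IsLocalRing (End (intervalModule K I)) := fun I => by
    by_cases h : I.1.Nonempty
    · exact Or.inr (isLocalRing_end_intervalModule h)
    · exact Or.inl (intervalModule_isZero h)
  apply le_antisymm
  · refine le_iInf fun A => le_iInf fun I' => le_iInf fun J' => le_iInf fun h1 => le_iInf fun h2 => ?_
    refine iInf_le_of_le A (iInf_le_of_le _ (iInf_le_of_le _ (iInf_le_of_le h1 (iInf_le_of_le h2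
      (iInf_le_of_le (fun a => hloc _) (iInf_le_of_le (fun a => hloc _) ?_))))))
    exact pNorm_mono fun a => (zigzagDist_intervalModule μ hm _ _).le
  · refine le_iInf fun A => le_iInf fun X => le_iInf fun Y => le_iInf fun h1 => le_iInf fun h2 =>
      le_iInf fun h3 => le_iInf fun h4 => ?_
    choose I' hI' using fun a => key hM h1 a (h3 a)
    choose J' hJ' using fun a => key hN h2 a (h4 a)
    refine iInf_le_of_le A (iInf_le_of_le I' (iInf_le_of_le J' (iInf_le_of_le
      ⟨h1.some ≪≫ Sigma.mapIso fun a => (hI' a).some⟩ (iInf_le_of_le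
      ⟨h2.some ≪≫ Sigma.mapIso fun a => (hJ' a).some⟩ ?_))))
    refine pNorm_mono fun a => ?_
    rw [← zigzagDist_intervalModule (K := K) μ hm]
    exact zigzagDist_le_of_iso μ (hI' a).some.symm (hJ' a).some.symm

end IntervalDistance
end AlgWass

namespace AlgWass

/-! ### Inequalities for `p`-norms -/

section Norms

theorem tsum_rpow_fin_three (a b c : ℝ≥0∞) (r : ℝ) :
    ∑' i, ![a, b, c] i ^ r = a ^ r + b ^ r + c ^ r := by
  rw [tsum_fintype, Fin.sum_univ_three]
  rfl

theorem tsum_rpow_le_of_injective {A Z : Type*} {x : A → ℝ≥0∞} {X : Z → ℝ≥0∞} {α : A → Z}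
    (hα : Function.Injective α) (hx : ∀ a, x a ≤ X (α a)) {r : ℝ} (hr : 0 ≤ r) :
    ∑' a, x a ^ r ≤ ∑' i, X i ^ r :=
  (ENNReal.tsum_le_tsum fun a => ENNReal.rpow_le_rpow (hx a) hr).trans
    (ENNReal.tsum_comp_le_tsum_of_injective hα fun i => X i ^ r)

theorem pNorm_sum_sum {p : ℝ≥0∞} (hp : 1 ≤ p) {A B C : Type*} (x : (A ⊕ B) ⊕ C → ℝ≥0∞) :
    pNorm p x = pNorm p ![pNorm p (fun a => x (Sum.inl (Sum.inl a))),
      pNorm p (fun b => x (Sum.inl (Sum.inr b))), pNorm p (fun c => x (Sum.inr c))] := by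
  unfold pNorm
  by_cases h : p = ∞
  · simp only [if_pos h]
    rw [iSup_sum, iSup_sum]
    apply le_antisymm
    · refine sup_le (sup_le ?_ ?_) ?_
      · exact le_iSup_of_le (0 : Fin 3) le_rfl
      · exact le_iSup_of_le (1 : Fin 3) le_rfl
      · exact le_iSup_of_le (2 : Fin 3) le_rfl
    · refine iSup_le fun i => ?_
      fin_cases i
      · exact le_sup_of_le_left le_sup_left
      · exact le_sup_of_le_left le_sup_right
      · exact le_sup_right
  · have hp0 : p.toReal ≠ 0 := (ENNReal.toReal_pos (zero_lt_one.trans_le hp).ne' h).ne'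
    simp only [if_neg h]
    refine congrArg (· ^ (1 / p.toReal)) (Eq.trans ?_ (tsum_rpow_fin_three _ _ _ _).symm)
    simp only [← ENNReal.rpow_mul, one_div, inv_mul_cancel₀ hp0, ENNReal.rpow_one]
    rw [Summable.tsum_sum ENNReal.summable ENNReal.summable,
      Summable.tsum_sum ENNReal.summable ENNReal.summable]

/-- Superadditivity of `t ↦ t ^ p` for `p ≥ 1` is the point: several contributions may fall on the
same index of `Z`, as happens when a disjoint pair is split into two unmatched points. -/
theorem pNorm_sum_le_of_injective {p : ℝ≥0∞} (hp : 1 ≤ p) {A B C Z : Type*} {x : A → ℝ≥0∞}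
    {y : B → ℝ≥0∞} {w : C → ℝ≥0∞} {z X Y W : Z → ℝ≥0∞} {α : A → Z} {β : B → Z} {γ : C → Z}
    (hα : Function.Injective α) (hβ : Function.Injective β) (hγ : Function.Injective γ)
    (hx : ∀ a, x a ≤ X (α a)) (hy : ∀ b, y b ≤ Y (β b)) (hw : ∀ c, w c ≤ W (γ c))
    (hz : ∀ i, X i + Y i + W i ≤ z i) :
    pNorm p ![pNorm p x, pNorm p y, pNorm p w] ≤ pNorm p z := by
  unfold pNorm
  by_cases h : p = ∞
  · simp only [if_pos h]
    refine iSup_le fun i => ?_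
    fin_cases i
    · exact iSup_le fun a => le_iSup_of_le (α a)
        ((hx a).trans ((le_self_add.trans le_self_add).trans (hz _)))
    · exact iSup_le fun a => le_iSup_of_le (β a)
        ((hy a).trans ((le_add_self.trans le_self_add).trans (hz _)))
    · exact iSup_le fun a => le_iSup_of_le (γ a) ((hw a).trans (le_add_self.trans (hz _)))
  · have hp0 : p.toReal ≠ 0 := (ENNReal.toReal_pos (zero_lt_one.trans_le hp).ne' h).ne'
    have hp1 : 1 ≤ p.toReal := (ENNReal.toReal_mono h hp)
    have hp2 := ENNReal.toReal_nonneg (a := p)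
    simp only [if_neg h]
    refine ENNReal.rpow_le_rpow ?_ (by simp)
    refine (tsum_rpow_fin_three _ _ _ _).trans_le ?_
    simp only [← ENNReal.rpow_mul, one_div, inv_mul_cancel₀ hp0, ENNReal.rpow_one]
    refine (add_le_add (add_le_add (tsum_rpow_le_of_injective hα hx hp2)
      (tsum_rpow_le_of_injective hβ hy hp2)) (tsum_rpow_le_of_injective hγ hw hp2)).trans ?_
    rw [← ENNReal.tsum_add, ← ENNReal.tsum_add]
    refine ENNReal.tsum_le_tsum fun i => ?_
    refine le_trans ?_ (ENNReal.rpow_le_rpow (hz i) (by simp))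
    exact (add_le_add (ENNReal.add_rpow_le_rpow_add _ _ hp1) le_rfl).trans
      (ENNReal.add_rpow_le_rpow_add _ _ hp1)

end Norms

/-! ### Interval decompositions and partial matchings -/

section Isometry

variable {K : Type u} [Field K] {P : Type} [LinearOrder P] [MeasurableSpace P]

/-- A partial matching gives compatible interval decompositions. -/
theorem intervalWasserstein_le_diagWasserstein {p : ℝ≥0∞} (hp : 1 ≤ p) (μ : Measure P)
    {x : Set P → EReal × EReal}
    (h1 : ∀ I : Intvl P, I.1.Nonempty → μ I.1 ≤ diagDist (x I.1))
    (h2 : ∀ I J : Intvl P, I.1.Nonempty → J.1.Nonempty →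
      μ (symmDiff I.1 J.1) ≤ ptDist (x I.1) (x J.1))
    {M N : PersMod K P} {D E : Diagram.{u}} (hM : IsDiagramOf x M D) (hN : IsDiagramOf x N E) :
    intervalWasserstein p μ M N ≤ diagWasserstein p D E := by
  classical
  obtain ⟨I, hI, hxI, eM⟩ := hM
  obtain ⟨J, hJ, hxJ, eN⟩ := hN
  refine le_iInf fun C => le_iInf fun φ => le_iInf fun hφ => ?_
  let O : Intvl P := ⟨∅, Set.ordConnected_empty⟩
  have hO : IsZero (intervalModule K O) := intervalModule_isZero Set.not_nonempty_empty
  let R : Set E.idx := (Set.range φ)ᶜ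
  let I' : (C ⊕ (Cᶜ : Set D.idx)) ⊕ R → Intvl P :=
    Sum.elim (Sum.elim (fun c => I c) (fun d => I d)) (fun _ => O)
  let J' : (C ⊕ (Cᶜ : Set D.idx)) ⊕ R → Intvl P :=
    Sum.elim (Sum.elim (fun c => J (φ c)) (fun _ => O)) (fun e => J e)
  -- The family `J'` reordered so that its empty intervals come last, where they can be dropped from
  -- the coproduct.
  let J'' : (C ⊕ R) ⊕ (Cᶜ : Set D.idx) → Intvl P :=
    Sum.elim (Sum.elim (fun c => J (φ c)) (fun e => J e)) (fun _ => O)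
  obtain ⟨i1⟩ := nonempty_iso_coprod_reindex (Equiv.Set.sumCompl C)
    (fun a => intervalModule K (I' (Sum.inl a))) (fun d => intervalModule K (I d))
    (by rintro (c | d) <;> rfl)
  obtain ⟨i2⟩ := nonempty_iso_coprod_sum (fun a => intervalModule K (I' a)) (fun _ => hO)
  let ε : C ⊕ R ≃ E.idx := (Equiv.sumCongr (Equiv.ofInjective φ hφ) (Equiv.refl R)).trans
    (Equiv.Set.sumCompl (Set.range φ))
  obtain ⟨j1⟩ := nonempty_iso_coprod_reindex ε
    (fun a => intervalModule K (J'' (Sum.inl a))) (fun d => intervalModule K (J d))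
    (by rintro (c | d) <;> rfl)
  obtain ⟨j2⟩ := nonempty_iso_coprod_sum (fun a => intervalModule K (J'' a)) (fun _ => hO)
  let δ : (C ⊕ R) ⊕ (Cᶜ : Set D.idx) ≃ (C ⊕ (Cᶜ : Set D.idx)) ⊕ R :=
    (Equiv.sumAssoc _ _ _).trans ((Equiv.sumCongr (Equiv.refl _) (Equiv.sumComm _ _)).trans
      (Equiv.sumAssoc _ _ _).symm)
  obtain ⟨j3⟩ := nonempty_iso_coprod_reindex δ
    (fun a => intervalModule K (J'' a)) (fun a => intervalModule K (J' a))
    (by rintro ((c | d) | e) <;> rfl)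
  refine iInf_le_of_le _ (iInf_le_of_le I' (iInf_le_of_le J' (iInf_le_of_le
    ⟨eM.some ≪≫ i1.symm ≪≫ i2⟩ (iInf_le_of_le ⟨eN.some ≪≫ j1.symm ≪≫ j2 ≪≫ j3⟩ ?_))))
  rw [pNorm_sum_sum hp]
  refine pNorm_mono fun i => ?_
  fin_cases i
  · refine pNorm_mono fun c => ?_
    rw [hxI, hxJ]
    exact h2 _ _ (hI _) (hJ _)
  · refine pNorm_mono fun d => ?_
    rw [hxI]
    refine le_trans (le_of_eq (congrArg μ ?_)) (h1 _ (hI _))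
    exact symmDiff_bot _
  · refine pNorm_mono fun d => ?_
    rw [hxJ]
    refine le_trans (le_of_eq (congrArg μ ?_)) (h1 _ (hJ _))
    exact bot_symmDiff _

/-- Compatible interval decompositions give a partial matching. -/
theorem diagWasserstein_le_intervalWasserstein {p : ℝ≥0∞} (hp : 1 ≤ p) (μ : Measure P)
    (hm : ∀ I : Intvl P, MeasurableSet I.1) {x : Set P → EReal × EReal}
    (h1 : ∀ I : Intvl P, I.1.Nonempty → diagDist (x I.1) ≤ μ I.1)
    (h2 : ∀ I J : Intvl P, (I.1 ∩ J.1).Nonempty →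
      ptDist (x I.1) (x J.1) ≤ μ (symmDiff I.1 J.1))
    {M N : PersMod K P} {D E : Diagram.{u}} (hM : IsDiagramOf x M D) (hN : IsDiagramOf x N E) :
    diagWasserstein p D E ≤ intervalWasserstein p μ M N := by
  classical
  obtain ⟨I, hI, hxI, eM⟩ := hM
  obtain ⟨J, hJ, hxJ, eN⟩ := hN
  refine le_iInf fun A => le_iInf fun I' => le_iInf fun J' => le_iInf fun fM => le_iInf fun fN => ?_
  obtain ⟨σ, hσ⟩ := exists_equiv_of_isDecomp eM fM hI
  obtain ⟨τ, hτ⟩ := exists_equiv_of_isDecomp eN fN hJ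
  -- Only intervals that meet are matched: for disjoint ones the distance of the diagram points can
  -- exceed the measure of the symmetric difference.
  let S : Set A := {a | ((I' a).1 ∩ (J' a).1).Nonempty}
  let C : Set D.idx := {d | (σ d).1 ∈ S}
  let φ : C → E.idx := fun c => τ.symm ⟨(σ c.1).1, c.2.mono Set.inter_subset_right⟩
  have hτφ : ∀ c, (τ (φ c)).1 = (σ c.1).1 := fun c => by simp [φ]
  have hφ : Function.Injective φ := fun c c' h => by
    have h3 : (σ c.1).1 = (σ c'.1).1 := by rw [← hτφ, ← hτφ, h]
    exact Subtype.ext (σ.injective (Subtype.ext h3))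
  refine iInf_le_of_le C (iInf_le_of_le φ (iInf_le_of_le hφ ?_))
  refine pNorm_sum_le_of_injective hp
    (X := fun a => if a ∈ S then μ (symmDiff (I' a).1 (J' a).1) else 0)
    (Y := fun a => if a ∈ S then 0 else μ (I' a).1)
    (W := fun a => if a ∈ S then 0 else μ (J' a).1)
    (α := fun c => (σ c.1).1) (β := fun d => (σ d.1).1) (γ := fun e => (τ e.1).1)
    (fun c c' h => Subtype.ext (σ.injective (Subtype.ext h)))
    (fun c c' h => Subtype.ext (σ.injective (Subtype.ext h)))
    (fun c c' h => Subtype.ext (τ.injective (Subtype.ext h))) ?_ ?_ ?_ ?_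
  · intro c
    have hc : (σ c.1).1 ∈ S := c.2
    have hJc : J' (σ c.1).1 = J (φ c) := by rw [← hτφ, hτ]
    rw [if_pos hc, hxI, hxJ, ← hσ, ← hJc]
    exact h2 _ _ hc
  · intro d
    have hd : (σ d.1).1 ∉ S := d.2
    rw [if_neg hd, hσ, hxI]
    exact h1 _ (hI _)
  · intro e
    have he : (τ e.1).1 ∉ S := by
      intro he
      refine e.2 ⟨⟨σ.symm ⟨(τ e.1).1, he.mono Set.inter_subset_left⟩, ?_⟩, ?_⟩
      · change (σ (σ.symm _)).1 ∈ S
        rw [Equiv.apply_symm_apply]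
        exact he
      · apply τ.injective
        apply Subtype.ext
        rw [hτφ]
        simp
    rw [if_neg he, hτ, hxJ]
    exact h1 _ (hJ _)
  · intro a
    by_cases ha : a ∈ S
    · simp [ha]
    · have hdisj : Disjoint (I' a).1 (J' a).1 :=
        Set.disjoint_iff_inter_eq_empty.2 (Set.not_nonempty_iff_eq_empty.1 ha)
      simp only [if_neg ha, zero_add]
      rw [← measure_union hdisj (hm _)]
      exact le_of_eq (congrArg μ hdisj.symmDiff_eq_sup.symm)

end Isometry
end AlgWass

namespace AlgWass

/-! ### Distances of diagram points as lengths of real intervals -/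

section ExtendedReals

/-- The real points of a half-open interval of extended reals. -/
def realIco (s t : EReal) : Set ℝ := {r | s ≤ (r : EReal) ∧ (r : EReal) < t}

theorem measurableSet_realIco (s t : EReal) : MeasurableSet (realIco s t) :=
  measurable_coe_real_ereal measurableSet_Ico

theorem realIco_eq_empty {s t : EReal} (h : t ≤ s) : realIco s t = ∅ :=
  Set.eq_empty_of_forall_notMem fun _ hr => (h.trans hr.1).not_gt hr.2

/-- At least one of the two intervals is empty. This form replaces subtraction of extended reals by
measures, so that later estimates become inclusions of sets. -/
theorem extDist_eq_volume (s t : EReal) :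
    extDist s t = volume (realIco s t) + volume (realIco t s) := by
  unfold extDist
  split_ifs with h
  · subst h
    rw [realIco_eq_empty le_rfl]
    simp
  · induction s with
    | bot =>
      rw [realIco_eq_empty (bot_le : ⊥ ≤ t)]
      induction t with
      | bot => exact absurd rfl h
      | coe t =>
        have : realIco ⊥ (t : EReal) = Set.Iio t := by ext r; simp [realIco]
        simp [this]
      | top =>
        have : realIco ⊥ ⊤ = Set.univ := by ext r; simp [realIco]
        simp [this]
    | coe s =>
      induction t with
      | bot =>
        have : realIco ⊥ (s : EReal) = Set.Iio s := by ext r; simp [realIco]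
        simp [this]
      | coe t =>
        have h1 : ∀ s t : ℝ, realIco (s : EReal) (t : EReal) = Set.Ico s t := fun s t => by
          ext r; simp [realIco]
        rw [h1, h1, Real.volume_Ico, Real.volume_Ico, ← EReal.coe_sub, EReal.abs_def]
        rcases le_total s t with h2 | h2
        · rw [abs_of_nonpos (by linarith), ENNReal.ofReal_of_nonpos (by linarith : s - t ≤ 0),
            add_zero, neg_sub]
        · rw [abs_of_nonneg (by linarith), ENNReal.ofReal_of_nonpos (by linarith : t - s ≤ 0),
            zero_add]
      | top =>
        have : realIco (s : EReal) ⊤ = Set.Ici s := by ext r; simp [realIco]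
        simp [this]
    | top =>
      rw [realIco_eq_empty (le_top : t ≤ ⊤)]
      induction t with
      | bot =>
        have : realIco ⊥ ⊤ = Set.univ := by ext r; simp [realIco]
        simp [this]
      | coe t =>
        have : realIco (t : EReal) ⊤ = Set.Ici t := by ext r; simp [realIco]
        simp [this]
      | top => exact absurd rfl h

/-- The infimum is attained at `z = x.2`; for any `z`, the interval is covered by its parts before
and after `z`. -/
theorem diagDist_eq_volume {x : EReal × EReal} (h : x.1 ≤ x.2) :
    diagDist x = volume (realIco x.1 x.2) := by
  apply le_antisymm
  · refine iInf_le_of_le x.2 ?_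
    simp [ptDist, extDist_eq_volume, realIco_eq_empty h, realIco_eq_empty (le_refl x.2)]
  · refine le_iInf fun z => ?_
    have : realIco x.1 x.2 ⊆ realIco x.1 z ∪ realIco z x.2 := fun r hr => by
      rcases lt_or_ge (r : EReal) z with h | h
      · exact Or.inl ⟨hr.1, h⟩
      · exact Or.inr ⟨h, hr.2⟩
    refine (measure_mono this).trans ((measure_union_le _ _).trans ?_)
    simp only [ptDist, extDist_eq_volume]
    exact add_le_add le_self_add le_add_self

theorem volume_realIco_diff_le (s t s' t' : EReal) :
    volume (realIco s t \ realIco s' t') ≤ volume (realIco s s') + volume (realIco t' t) := by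
  refine (measure_mono fun r hr => ?_).trans (measure_union_le _ _)
  rcases lt_or_ge (r : EReal) s' with h | h
  · exact Or.inl ⟨hr.1.1, h⟩
  · exact Or.inr ⟨le_of_not_gt fun h' => hr.2 ⟨h, h'⟩, hr.1.2⟩

/-- The common point `e` separates the two overhangs: `[s, s')` lies before it and `[t', t)` from it
onwards, so they are disjoint. -/
theorem le_volume_realIco_diff {s t s' t' e : EReal} (hs : s ≤ e) (ht : e ≤ t)
    (hs' : s' ≤ e) (ht' : e ≤ t') :
    volume (realIco s s') + volume (realIco t' t) ≤ volume (realIco s t \ realIco s' t') := by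
  rw [← measure_union _ (measurableSet_realIco _ _)]
  · refine measure_mono ?_
    rintro r (hr | hr)
    · exact ⟨⟨hr.1, hr.2.trans_le (hs'.trans ht)⟩, fun h => hr.2.not_ge h.1⟩
    · exact ⟨⟨hs.trans (ht'.trans hr.1), hr.2⟩, fun h => hr.1.not_gt h.2⟩
  · exact Set.disjoint_left.2 fun r hr hr' => (hr.2.trans_le (hs'.trans (ht'.trans hr'.1))).false

theorem volume_symmDiff_realIco_le (x y : EReal × EReal) :
    volume (symmDiff (realIco x.1 x.2) (realIco y.1 y.2)) ≤ ptDist x y := by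
  refine (measure_union_le _ _).trans ((add_le_add (volume_realIco_diff_le _ _ _ _)
    (volume_realIco_diff_le _ _ _ _)).trans (le_of_eq ?_))
  simp only [ptDist, extDist_eq_volume]
  ring

theorem ptDist_le_volume_symmDiff {x y : EReal × EReal} {e : EReal} (h1 : x.1 ≤ e) (h2 : e ≤ x.2)
    (h3 : y.1 ≤ e) (h4 : e ≤ y.2) :
    ptDist x y ≤ volume (symmDiff (realIco x.1 x.2) (realIco y.1 y.2)) := by
  rw [Set.symmDiff_def, measure_union (Set.disjoint_left.2 fun a ha hb => ha.2 hb.1)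
    ((measurableSet_realIco _ _).diff (measurableSet_realIco _ _))]
  refine le_trans (le_of_eq ?_) (add_le_add (le_volume_realIco_diff h1 h2 h3 h4)
    (le_volume_realIco_diff h3 h4 h1 h2))
  simp only [ptDist, extDist_eq_volume]
  ring

theorem volume_preimage_singleton (t : EReal) : volume {r : ℝ | (r : EReal) = t} = 0 :=
  Set.Subsingleton.measure_zero
    (fun _ hr _ hr' => EReal.coe_injective (hr.trans hr'.symm)) _

end ExtendedReals

/-! ### Transfer to real intervals -/

section Realization

variable {K : Type u} [Field K] {P : Type} [LinearOrder P] [MeasurableSpace P]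

/-- The comparison with the diagrams, given a realization of the intervals of `P` by real
intervals. -/
theorem intervalWasserstein_eq_diagWasserstein {p : ℝ≥0∞} (hp : 1 ≤ p) (μ : Measure P)
    (hm : ∀ I : Intvl P, MeasurableSet I.1) {x : Set P → EReal × EReal} (e : P → EReal)
    (hx : ∀ (I : Intvl P), ∀ a ∈ I.1, (x I.1).1 ≤ e a ∧ e a ≤ (x I.1).2) (Φ : Set P → Set ℝ)
    (hμ : ∀ S, MeasurableSet S → μ S = volume (Φ S))
    (hΦ : ∀ S T, Φ (symmDiff S T) = symmDiff (Φ S) (Φ T))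
    (hI : ∀ I : Intvl P, I.1.Nonempty → Φ I.1 =ᵐ[volume] realIco (x I.1).1 (x I.1).2)
    {M N : PersMod K P} {D E : Diagram.{u}} (hM : IsDiagramOf x M D) (hN : IsDiagramOf x N E) :
    intervalWasserstein p μ M N = diagWasserstein p D E := by
  have h1 : ∀ I : Intvl P, I.1.Nonempty → μ I.1 = diagDist (x I.1) := fun I hne => by
    obtain ⟨a, ha⟩ := hne
    rw [diagDist_eq_volume ((hx I a ha).1.trans (hx I a ha).2), hμ _ (hm I),
      measure_congr (hI I ⟨a, ha⟩)]
  have h2 : ∀ I J : Intvl P, I.1.Nonempty → J.1.Nonempty → μ (symmDiff I.1 J.1) =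
      volume (symmDiff (realIco (x I.1).1 (x I.1).2) (realIco (x J.1).1 (x J.1).2)) := by
    intro I J h h'
    rw [hμ _ ((hm I).symmDiff (hm J)), hΦ]
    exact measure_congr (((hI I h).diff (hI J h')).union ((hI J h').diff (hI I h)))
  apply le_antisymm
  · refine intervalWasserstein_le_diagWasserstein hp μ (fun I h => (h1 I h).le)
      (fun I J h h' => ?_) hM hN
    rw [h2 I J h h']
    exact volume_symmDiff_realIco_le _ _
  · refine diagWasserstein_le_intervalWasserstein hp μ hm (fun I h => (h1 I h).ge)
      (fun I J h => ?_) hM hN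
    obtain ⟨a, ha, ha'⟩ := h
    rw [h2 I J ⟨a, ha⟩ ⟨a, ha'⟩]
    exact ptDist_le_volume_symmDiff (hx I a ha).1 (hx I a ha).2 (hx J a ha').1 (hx J a ha').2

/-- Beyond the holes excluded by `h2`, the sets can differ only at the end points. -/
theorem ae_eq_realIco {S : Set ℝ} {s t : EReal}
    (h1 : ∀ r ∈ S, s ≤ (r : EReal) ∧ (r : EReal) ≤ t)
    (h2 : volume {r : ℝ | s < r ∧ (r : EReal) < t ∧ r ∉ S} = 0) :
    S =ᵐ[volume] realIco s t := by
  rw [ae_eq_set]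
  constructor
  · refine measure_mono_null (fun r hr => ?_) (volume_preimage_singleton t)
    have := h1 r hr.1
    exact le_antisymm this.2 (le_of_not_gt fun h => hr.2 ⟨this.1, h⟩)
  · refine measure_mono_null (fun r hr => ?_)
      (measure_union_null (volume_preimage_singleton s) h2)
    rcases hr.1.1.eq_or_lt with h | h
    · exact Or.inl h.symm
    · exact Or.inr ⟨h, hr.1.2, hr.2⟩

end Realization

/-! ### Realizations for subsets of the reals and of the integers -/

section Subsets

/-- An interval of `P` is the trace of its convex hull in the real line, which is Borel. -/
theorem measurableSet_interval_real {P : Set ℝ} (I : Intvl P) : MeasurableSet I.1 := by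
  let H : Set ℝ := {r | ∃ a ∈ I.1, ∃ b ∈ I.1, (a : ℝ) ≤ r ∧ r ≤ b}
  have hH : H.OrdConnected := ⟨fun _ ⟨a, ha, _, _, h, _⟩ _ ⟨_, _, b, hb, _, h'⟩ _ hz =>
    ⟨a, ha, b, hb, h.trans hz.1, hz.2.trans h'⟩⟩
  have hIH : I.1 = Subtype.val ⁻¹' H := Set.Subset.antisymm
    (fun a ha => ⟨a, ha, a, ha, le_rfl, le_rfl⟩)
    (fun _ ⟨_, ha, _, hb, h, h'⟩ => I.2.out ha hb ⟨h, h'⟩)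
  rw [hIH]
  exact measurable_subtype_coe hH.measurableSet

theorem comap_volume_apply {P : Set ℝ} (hP : NullMeasurableSet P volume) {S : Set P}
    (hS : MeasurableSet S) :
    Measure.comap (Subtype.val : P → ℝ) volume S = volume (Subtype.val '' S) :=
  Measure.comap_apply₀ _ _ Subtype.val_injective
    (fun _ => Measure.MeasurableSet.nullMeasurableSet_subtype_coe hP) hS.nullMeasurableSet

theorem image_interval_ae_eq {P : Set ℝ} (hP : volume (convexHull ℝ P \ P) = 0) (I : Intvl P) :
    (Subtype.val '' I.1 : Set ℝ) =ᵐ[volume] realIco (realPoint I.1).1 (realPoint I.1).2 := by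
  refine ae_eq_realIco ?_ (measure_mono_null ?_ hP)
  · rintro _ ⟨a, ha, rfl⟩
    exact ⟨iInf₂_le (f := fun (a : P) (_ : a ∈ I.1) => ((a : ℝ) : EReal)) a ha,
      le_iSup₂ (f := fun (a : P) (_ : a ∈ I.1) => ((a : ℝ) : EReal)) a ha⟩
  · rintro r ⟨h1, h2, h3⟩
    simp only [realPoint, iInf_lt_iff, lt_iSup_iff, EReal.coe_lt_coe_iff] at h1 h2
    obtain ⟨a, ha, h1⟩ := h1
    obtain ⟨b, hb, h2⟩ := h2
    -- A real number between two points of `I` but outside `I` cannot belong to `P`, so it lies in a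
    -- gap.
    refine ⟨(convex_convexHull ℝ P).ordConnected.out (subset_convexHull ℝ P a.2)
      (subset_convexHull ℝ P b.2) ⟨h1.le, h2.le⟩, fun hr => h3 ⟨⟨r, hr⟩, ?_, rfl⟩⟩
    exact I.2.out ha hb ⟨h1.le, h2.le⟩

/-- The union of the real intervals `[n, n + 1)` with `n` in a set of integers. -/
def intRealization {P : Set ℤ} (S : Set P) : Set ℝ := {r | ∃ n ∈ S, (n : ℤ) = ⌊r⌋}

theorem intRealization_symmDiff {P : Set ℤ} (S T : Set P) :
    intRealization (symmDiff S T) = symmDiff (intRealization S) (intRealization T) := by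
  have key : ∀ S T : Set P, intRealization (S \ T) = intRealization S \ intRealization T := by
    intro S T
    ext r
    constructor
    · rintro ⟨n, hn, h⟩
      refine ⟨⟨n, hn.1, h⟩, ?_⟩
      rintro ⟨m, hm, h'⟩
      exact hn.2 (Subtype.ext (h.trans h'.symm) ▸ hm)
    · rintro ⟨⟨n, hn, h⟩, h'⟩
      exact ⟨n, ⟨hn, fun hT => h' ⟨n, hT, h⟩⟩, h⟩
  rw [Set.symmDiff_def, Set.symmDiff_def, ← key, ← key]
  ext r
  constructor
  · rintro ⟨n, hn | hn, h⟩
    · exact Or.inl ⟨n, hn, h⟩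
    · exact Or.inr ⟨n, hn, h⟩
  · rintro (⟨n, hn, h⟩ | ⟨n, hn, h⟩)
    · exact ⟨n, Or.inl hn, h⟩
    · exact ⟨n, Or.inr hn, h⟩

theorem count_eq_volume_intRealization {P : Set ℤ} (S : Set P) :
    Measure.count S = volume (intRealization S) := by
  have h : intRealization S = ⋃ n ∈ S, Set.Ico ((n : ℤ) : ℝ) ((n : ℤ) + 1) := by
    ext r
    simp only [intRealization, Set.mem_iUnion, Set.mem_ofPred_eq, Set.mem_Ico, exists_prop]
    refine exists_congr fun n => and_congr_right fun _ => ?_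
    rw [eq_comm, Int.floor_eq_iff]
  rw [h, measure_biUnion S.to_countable _ fun _ _ => measurableSet_Ico]
  · simp only [Real.volume_Ico, add_sub_cancel_left, ENNReal.ofReal_one]
    rw [ENNReal.tsum_set_one, Measure.count_apply (MeasurableSet.of_discrete)]
  · intro n _ m _ hnm
    refine Set.disjoint_left.2 fun r hr hr' => hnm (Subtype.ext ?_)
    rw [← Int.floor_eq_iff.2 hr, ← Int.floor_eq_iff.2 hr']

theorem intRealization_ae_eq {P : Set ℤ} (hP : P.OrdConnected) (I : Intvl P) :
    intRealization I.1 =ᵐ[volume] realIco (intPoint I.1).1 (intPoint I.1).2 := by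
  refine ae_eq_realIco ?_ (measure_mono_null ?_ (measure_empty (μ := volume)))
  · rintro r ⟨n, hn, h⟩
    have h1 : ((n : ℤ) : ℝ) ≤ r := by rw [h]; exact Int.floor_le r
    have h2 : r ≤ ((n : ℤ) : ℝ) + 1 := by rw [h]; exact (Int.lt_floor_add_one r).le
    exact ⟨(iInf₂_le (f := fun (a : P) (_ : a ∈ I.1) => (((a : ℤ) : ℝ) : EReal)) n hn).trans
      (EReal.coe_le_coe_iff.2 h1), (EReal.coe_le_coe_iff.2 h2).trans
      (le_iSup₂ (f := fun (a : P) (_ : a ∈ I.1) => ((((a : ℤ) : ℝ) + 1 : ℝ) : EReal)) n hn)⟩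
  · rintro r ⟨h1, h2, h3⟩
    simp only [intPoint, iInf_lt_iff, lt_iSup_iff, EReal.coe_lt_coe_iff] at h1 h2
    obtain ⟨a, ha, h1⟩ := h1
    obtain ⟨b, hb, h2⟩ := h2
    have ha' : (a : ℤ) ≤ ⌊r⌋ := Int.le_floor.2 h1.le
    -- Here the shift by one in the second coordinate enters: `r < b + 1`, not `r < b`, is what is
    -- known.
    have hb' : ⌊r⌋ ≤ (b : ℤ) := Int.lt_add_one_iff.1 (Int.floor_lt.2 (by exact_mod_cast h2))
    exact h3 ⟨⟨⌊r⌋, hP.out a.2 b.2 ⟨ha', hb'⟩⟩, I.2.out ha hb ⟨ha', hb'⟩, rfl⟩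

end Subsets
end AlgWass

theorem mainTheorem1 {K : Type u} [Field K] (p : ℝ≥0∞) (hp : 1 ≤ p) :
    (∀ P : Set ℝ, NullMeasurableSet P volume →
      ∀ (M N : AlgWass.PersMod K P) (D E : AlgWass.Diagram.{u}),
        AlgWass.IsDiagramOf AlgWass.realPoint M D →
        AlgWass.IsDiagramOf AlgWass.realPoint N E →
          AlgWass.algWasserstein p
              (AlgWass.zigzagDist (Measure.comap (Subtype.val : P → ℝ) volume)) M N
            = AlgWass.intervalWasserstein p (Measure.comap (Subtype.val : P → ℝ) volume) M N ∧
          (volume (convexHull ℝ P \ P) = 0 →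
            AlgWass.intervalWasserstein p (Measure.comap (Subtype.val : P → ℝ) volume) M N
              = AlgWass.diagWasserstein p D E)) ∧
    (∀ P : Set ℤ,
      ∀ (M N : AlgWass.PersMod K P) (D E : AlgWass.Diagram.{u}),
        AlgWass.IsDiagramOf AlgWass.intPoint M D →
        AlgWass.IsDiagramOf AlgWass.intPoint N E →
          AlgWass.algWasserstein p (AlgWass.zigzagDist (Measure.count : Measure P)) M N
            = AlgWass.intervalWasserstein p (Measure.count : Measure P) M N ∧
          (P.OrdConnected →
            AlgWass.intervalWasserstein p (Measure.count : Measure P) M N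
              = AlgWass.diagWasserstein p D E)) := by
  constructor
  · intro P hP M N D E hM hN
    refine ⟨?_, fun hgap => ?_⟩
    · obtain ⟨_, _, _, eM⟩ := hM
      obtain ⟨_, _, _, eN⟩ := hN
      exact AlgWass.algWasserstein_eq_intervalWasserstein p _ AlgWass.measurableSet_interval_real
        eM eN
    · exact AlgWass.intervalWasserstein_eq_diagWasserstein hp _ AlgWass.measurableSet_interval_real
        (fun a => ((a : ℝ) : EReal))
        (fun I a ha => ⟨iInf₂_le (f := fun (a : P) (_ : a ∈ I.1) => ((a : ℝ) : EReal)) a ha,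
          le_iSup₂ (f := fun (a : P) (_ : a ∈ I.1) => ((a : ℝ) : EReal)) a ha⟩)
        (fun S => Subtype.val '' S) (fun S hS => AlgWass.comap_volume_apply hP hS)
        (fun S T => Set.image_symmDiff Subtype.val_injective S T)
        (fun I _ => AlgWass.image_interval_ae_eq hgap I) hM hN
  · intro P M N D E hM hN
    refine ⟨?_, fun hgap => ?_⟩
    · obtain ⟨_, _, _, eM⟩ := hM
      obtain ⟨_, _, _, eN⟩ := hN
      exact AlgWass.algWasserstein_eq_intervalWasserstein p _ (fun _ => MeasurableSet.of_discrete)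
        eM eN
    · refine AlgWass.intervalWasserstein_eq_diagWasserstein hp _
        (fun _ => MeasurableSet.of_discrete) (fun a : P => (((a : ℤ) : ℝ) : EReal))
        (fun I a ha => ⟨iInf₂_le (f := fun (a : P) (_ : a ∈ I.1) => (((a : ℤ) : ℝ) : EReal)) a ha,
          le_trans (EReal.coe_le_coe_iff.2 (by linarith)) (le_iSup₂ (f := fun (a : P)
            (_ : a ∈ I.1) => ((((a : ℤ) : ℝ) + 1 : ℝ) : EReal)) a ha)⟩)
        AlgWass.intRealization (fun S _ => AlgWass.count_eq_volume_intRealization S)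
        AlgWass.intRealization_symmDiff
        (fun I _ => AlgWass.intRealization_ae_eq hgap I) hM hN
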